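/- Let $R$ be a commutative ring with unit and let $r\ge 0$. For $i\ge 0$, an $i$-bigraded complex is a family of $R$-modules $A^{p,n}$, $p,n\in\mathbb{Z}$, with differentials $d_i\colon A^{p,n}\to A^{p-i,n+1-i}$ such that $d_i^2=0$. An extended spectral sequence is a family of $i$-bigraded complexes $(X_i,d_i)$, $i\ge 0$, together with morphisms of bigraded $R$-modules $\varphi_{i+1}\colon X_{i+1}\to H(X_i)$, $i\ge 0$ (not required to be isomorphisms). A morphism of extended spectral sequences is a family of morphisms $f_i\colon X_i\to Y_i$ of $i$-bigraded complexes compatible with the maps $\varphi$. Let $\mathsf{eSpSe}$ denote the category of extended spectral sequences. Let - $\mathcal{F}ib_r$ be the class of morphisms $f$ such that $f_i$ is surjective in every bidegree for $0\le i\le r$; - $\mathcal{E}_r$ be the class of morphisms $f$ such that $f_r$ is a quasi-isomorphism; - $\mathcal{E}'_r\subset\mathcal{E}_r$ be the class of morphisms $f$ such that $f_r$ is a quasi-isomorphism and $f_s$ is an isomorphism for all $s>r$. The category $\mathsf{eSpSe}$ has all small limits and colimits, and it carries a model structure $\mathsf{eSpSe}_r$ with fibrations $\mathcal{F}ib_r$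 and weak equivalences $\mathcal{E}_r$, and a model structure $\mathsf{eSpSe}'_r$ with fibrations $\mathcal{F}ib_r$ and weak equivalences $\mathcal{E}'_r$. The identity functor $\mathsf{eSpSe}'_r\to\mathsf{eSpSe}_r$ is a right Bousfield localization, that is, the two model structures have the same fibrations and every weak equivalence of $\mathsf{eSpSe}'_r$ is a weak equivalence of $\mathsf{eSpSe}_r$. In particular, it is a right Quillen functor, with left adjoint the identity functor $\mathsf{eSpSe}_r\to\mathsf{eSpSe}'_r$. If $R\neq 0$, this Quillen adjunction is not a Quillen equivalence. -/

import Mathlib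

open CategoryTheory Limits HomotopicalAlgebra

universe v₁ v₂ u₁ u₂ u

/-! ### Bigraded complexes and extended spectral sequences -/

/-- `r`-bigraded complexes of `R`-modules: families `A^{p,n}` of `R`-modules, `p, n ∈ ℤ`, with
differentials `d_r : A^{p,n} ⟶ A^{p-r,n+1-r}` of square zero. -/
abbrev BigradedComplex (R : Type u) [CommRing R] (r : ℕ) :=
  HomologicalComplex (ModuleCat.{u} R) (ComplexShape.up' ((-(r : ℤ), 1 - (r : ℤ)) : ℤ × ℤ))

/-- An extended spectral sequence: an `r`-bigraded complex `X_r` for every `r ≥ 0` (the pages),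
with characteristic maps `φ_{r+1} : X_{r+1} ⟶ H(X_r)` of bigraded `R`-modules, which need not
be isomorphisms. -/
structure ExtendedSpectralSequence (R : Type u) [CommRing R] where
  /-- the `r`-th page -/
  page (r : ℕ) : BigradedComplex R r
  /-- the characteristic map `φ_{r+1}`, in each bidegree -/
  char (r : ℕ) (pn : ℤ × ℤ) : (page (r + 1)).X pn ⟶ (page r).homology pn

namespace ExtendedSpectralSequence

variable {R : Type u} [CommRing R]

/-- A morphism of extended spectral sequences: morphisms of `r`-bigraded complexes
`f_r : X_r ⟶ Y_r` for all `r ≥ 0`, compatible with the characteristic maps. -/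
@[ext]
structure Hom (X Y : ExtendedSpectralSequence R) where
  /-- the component on the `r`-th page -/
  hom (r : ℕ) : X.page r ⟶ Y.page r
  comm (r : ℕ) (pn : ℤ × ℤ) :
    X.char r pn ≫ HomologicalComplex.homologyMap (hom r) pn =
      (hom (r + 1)).f pn ≫ Y.char r pn

instance : Category (ExtendedSpectralSequence R) where
  Hom := Hom
  id X :=
    { hom := fun r => 𝟙 (X.page r)
      comm := by intro r pn; simp }
  comp f g :=
    { hom := fun r => f.hom r ≫ g.hom r
      comm := by
        intro r pn
        rw [HomologicalComplex.homologyMap_comp, ← Category.assoc, f.comm, Category.assoc,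
          g.comm, HomologicalComplex.comp_f, Category.assoc] }

variable (R)

/-- The class `Fib_r` of maps `f` such that `f_i` is surjective in each bidegree
for all `0 ≤ i ≤ r`. -/
def fib (r : ℕ) : MorphismProperty (ExtendedSpectralSequence R) :=
  fun _ _ f => ∀ i : ℕ, i ≤ r → ∀ pn : ℤ × ℤ, Function.Surjective ((f.hom i).f pn)

/-- The class `E_r` of maps `f` such that `f_r` is a quasi-isomorphism. -/
def weq (r : ℕ) : MorphismProperty (ExtendedSpectralSequence R) :=
  fun _ _ f => QuasiIso (f.hom r)

/-- The class `E'_r` of maps `f` such that `f_r` is a quasi-isomorphism and `f_s` is an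
isomorphism for all `s > r`. -/
def weq' (r : ℕ) : MorphismProperty (ExtendedSpectralSequence R) :=
  fun _ _ f => QuasiIso (f.hom r) ∧ ∀ s : ℕ, r < s → IsIso (f.hom s)

end ExtendedSpectralSequence

/-! ### Comparison of model structures -/

namespace HomotopicalAlgebra.ModelCategory

section

variable {C : Type u₁} [Category.{v₁} C]

/-- The class of fibrations of the model structure `M`. -/
abbrev Fib (M : ModelCategory C) : MorphismProperty C :=
  @fibrations C _ M.categoryWithFibrations

/-- The class of cofibrations of the model structure `M`. -/
abbrev Cof (M : ModelCategory C) : MorphismProperty C :=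
  @cofibrations C _ M.categoryWithCofibrations

/-- The class of weak equivalences of the model structure `M`. -/
abbrev Weq (M : ModelCategory C) : MorphismProperty C :=
  @weakEquivalences C _ M.categoryWithWeakEquivalences

/-- The model structure `N` is a right Bousfield localization of the model structure `M` on the
same category: the fibrations are the same and every weak equivalence of `M` is one of `N`. -/
structure IsRightBousfieldLocalization (M N : ModelCategory C) : Prop where
  fib_eq : N.Fib = M.Fib
  weq_le : M.Weq ≤ N.Weq

end

section

variable {C : Type u₁} [Category.{v₁} C] {D : Type u₂} [Category.{v₂} D]

/-- The adjunction `F ⊣ G` is a Quillen adjunction from `M` to `N`: the left adjoint preserves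
cofibrations and trivial cofibrations. -/
structure IsQuillenAdjunction (M : ModelCategory C) (N : ModelCategory D)
    {F : C ⥤ D} {G : D ⥤ C} (_adj : F ⊣ G) : Prop where
  cof {X Y : C} (f : X ⟶ Y) : M.Cof f → N.Cof (F.map f)
  trivialCof {X Y : C} (f : X ⟶ Y) : M.Cof f → M.Weq f → N.Cof (F.map f) ∧ N.Weq (F.map f)

/-- The adjunction `F ⊣ G` is a Quillen equivalence from `M` to `N`: it is a Quillen adjunction
and, for all `X` cofibrant in `M` and `Y` fibrant in `N`, a map `F X ⟶ Y` is a weak equivalence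
in `N` if and only if its adjoint `X ⟶ G Y` is a weak equivalence in `M`. -/
structure IsQuillenEquivalence (M : ModelCategory C) (N : ModelCategory D)
    {F : C ⥤ D} {G : D ⥤ C} (adj : F ⊣ G) : Prop extends IsQuillenAdjunction M N adj where
  weq_iff {X : C} {Y : D} (hX : IsCofibrant X) (hY : IsFibrant Y) (f : F.obj X ⟶ Y) :
    N.Weq f ↔ M.Weq (adj.homEquiv X Y f)

end

end HomotopicalAlgebra.ModelCategory

/-! With fibrations `F` and weak equivalences `W` closed under retracts and `W` satisfying two out
of three, a model structure on a finitely complete and cocomplete category follows from two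
factorizations: one through `(F ⊓ W).llp` and `F ⊓ W`, one through `F.llp ⊓ W` and `F`. The retract
argument (`HasFactorizations.llp_inf_eq`) identifies trivial cofibrations with `F.llp`. Both
structures here share `F`, hence also their trivial cofibrations, and the smaller class of weak
equivalences has more cofibrations; this gives the Quillen adjunction.

The factorizations are built by induction on `r`, peeling off page 0. For `r = 0` one factors `f_0`
as a map of complexes and transports the characteristic maps along homology. For the inductive step
(`exists_cons_factorization`), the factored tail has first page `X_1 ⊕ V` with `V` projective. The
new page 0 is `X_0 ⊕ V ⊕ F`: `V` has zero differential and carries the homology classes needed by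
the new characteristic map, and `F` is a free complex forcing surjectivity onto `Y_0`. Lifts exist
on `V` because, along a surjection of complexes, a homology class and a cycle with matching images
come from one cycle (`exists_cycles_of_surjective`). The induction survives because page 0 of the
left factor is again split with projective complement.

Colimits are pagewise. Limits are not, as homology does not preserve them: page `s + 1` is the
universal complex over the limit of the pages with a compatible map to the homology of the limit
page `s`.

The adjunction is not an equivalence because a sequence vanishing up to page `r` but not on page `r
+ 1` is equivalent to zero for `weq` and not for `weq'`. -/

lemma ModuleCat.pullback_ext {R : Type u} [CommRing R] {A B C : ModuleCat.{u} R} (f : A ⟶ C)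
    (g : B ⟶ C) {x y : ↑(pullback f g)} (h₁ : pullback.fst f g x = pullback.fst f g y)
    (h₂ : pullback.snd f g x = pullback.snd f g y) : x = y := by
  have : ModuleCat.ofHom (LinearMap.toSpanSingleton R _ x) =
      ModuleCat.ofHom (LinearMap.toSpanSingleton R _ y) := by
    apply pullback.hom_ext <;> ext <;> simpa
  simpa using ConcreteCategory.congr_hom this (1 : R)

/-! ### Cycles, homology classes and quasi-isomorphisms, in terms of elements. -/

namespace HomologicalComplex

section Elements

variable {R : Type u} [CommRing R] {ι : Type*} {c : ComplexShape ι}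
  (K : HomologicalComplex (ModuleCat.{u} R) c)

lemma homologyπ_surjective (i : ι) : Function.Surjective (K.homologyπ i) :=
  (ModuleCat.epi_iff_surjective _).1 inferInstance

lemma iCycles_injective (i : ι) : Function.Injective (K.iCycles i) :=
  (ModuleCat.mono_iff_injective _).1 inferInstance

lemma exists_cycles {i : ι} (x : K.X i) (hx : K.d i (c.next i) x = 0) :
    ∃ z : K.cycles i, K.iCycles i z = x :=
  (ShortComplex.moduleCat_exact_iff _).1
    (ShortComplex.exact_of_f_is_kernel (ShortComplex.mk _ _ (K.iCycles_d i (c.next i)))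
      (K.cyclesIsKernel i _ rfl)) x hx

lemma d_iCycles_apply {i j : ι} (z : K.cycles i) : K.d i j (K.iCycles i z) = 0 := by
  rw [← ConcreteCategory.comp_apply, K.iCycles_d]
  rfl

lemma iCycles_toCycles_apply {i j : ι} (x : K.X i) :
    K.iCycles j (K.toCycles i j x) = K.d i j x := by
  rw [← ConcreteCategory.comp_apply, K.toCycles_i]

lemma homologyπ_toCycles_apply {i j : ι} (x : K.X i) :
    K.homologyπ j (K.toCycles i j x) = 0 := by
  rw [← ConcreteCategory.comp_apply, K.toCycles_comp_homologyπ]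
  rfl

lemma exists_toCycles_eq {i : ι} (z : K.cycles i) (hz : K.homologyπ i z = 0) :
    ∃ x : K.X (c.prev i), K.toCycles (c.prev i) i x = z :=
  (ShortComplex.moduleCat_exact_iff _).1
    (ShortComplex.exact_of_g_is_cokernel
      (ShortComplex.mk _ _ (K.toCycles_comp_homologyπ (c.prev i) i))
      (K.homologyIsCokernel _ i rfl)) z hz

variable {K} {L : HomologicalComplex (ModuleCat.{u} R) c} (f : K ⟶ L)

lemma iCycles_cyclesMap_apply {i : ι} (z : K.cycles i) :
    L.iCycles i (cyclesMap f i z) = f.f i (K.iCycles i z) := by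
  rw [← ConcreteCategory.comp_apply, cyclesMap_i, ConcreteCategory.comp_apply]

lemma homologyMap_homologyπ_apply {i : ι} (z : K.cycles i) :
    homologyMap f i (K.homologyπ i z) = L.homologyπ i (cyclesMap f i z) := by
  rw [← ConcreteCategory.comp_apply, homologyπ_naturality, ConcreteCategory.comp_apply]

lemma hom_d_apply {i j : ι} (x : K.X i) : f.f j (K.d i j x) = L.d i j (f.f i x) := by
  rw [← ConcreteCategory.comp_apply, ← f.comm, ConcreteCategory.comp_apply]

lemma d_d_apply {i j k : ι} (x : K.X i) : K.d j k (K.d i j x) = 0 := by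
  rw [← ConcreteCategory.comp_apply, K.d_comp_d]
  rfl

lemma toCycles_naturality_apply {i j : ι} (x : K.X i) :
    cyclesMap f j (K.toCycles i j x) = L.toCycles i j (f.f i x) := by
  apply L.iCycles_injective
  rw [iCycles_cyclesMap_apply, iCycles_toCycles_apply, iCycles_toCycles_apply, hom_d_apply]

lemma quasiIso_iff_bijective :
    QuasiIso f ↔ ∀ i, Function.Bijective (homologyMap f i) := by
  rw [quasiIso_iff]
  refine forall_congr' fun i => ?_
  rw [quasiIsoAt_iff_isIso_homologyMap, ConcreteCategory.isIso_iff_bijective]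

/-- If `f` is surjective, a homology class of `K` and a cycle of `L` with the same image in the
homology of `L` come from a common cycle of `K`. -/
lemma exists_cycles_of_surjective (hf : ∀ i, Function.Surjective (f.f i)) {i : ι}
    (h : K.homology i) (z : L.cycles i) (hz : homologyMap f i h = L.homologyπ i z) :
    ∃ w : K.cycles i, K.homologyπ i w = h ∧ cyclesMap f i w = z := by
  obtain ⟨w, rfl⟩ := K.homologyπ_surjective i h
  rw [homologyMap_homologyπ_apply, ← sub_eq_zero, ← map_sub] at hz
  -- The image of `w` differs from `z` by a boundary; lifting its primitive `b` to `K` allows `w` to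
  -- be corrected without changing its class.
  obtain ⟨b, hb⟩ := L.exists_toCycles_eq _ hz
  obtain ⟨b, rfl⟩ := hf _ b
  refine ⟨w - K.toCycles _ i b, ?_, ?_⟩
  · rw [map_sub, homologyπ_toCycles_apply, sub_zero]
  · rw [map_sub, toCycles_naturality_apply, hb, sub_sub_cancel]

/-- Surjective quasi-isomorphisms lift solutions of the equation `d x = z`. -/
lemma exists_lift_of_quasiIso (hf : ∀ i, Function.Surjective (f.f i)) [QuasiIso f] {i j : ι}
    (hij : c.Rel i j) (y : L.X i) (z : K.X j) (hz : K.d j (c.next j) z = 0)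
    (h : f.f j z = L.d i j y) :
    ∃ x : K.X i, K.d i j x = z ∧ f.f i x = y := by
  have hq := (quasiIso_iff_bijective f).1 inferInstance
  obtain rfl := c.prev_eq' hij
  obtain ⟨z, rfl⟩ := K.exists_cycles z hz
  have : K.homologyπ j z = 0 := by
    apply (hq j).1
    rw [map_zero, homologyMap_homologyπ_apply]
    convert! L.homologyπ_toCycles_apply y
    apply L.iCycles_injective
    rw [iCycles_cyclesMap_apply, h, iCycles_toCycles_apply]
  obtain ⟨x, rfl⟩ := K.exists_toCycles_eq z this
  rw [iCycles_toCycles_apply] at h ⊢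
  -- The primitive `x` of `z` need not lie over `y`, but the error is a cycle, which lifts to a
  -- cycle of `K` on the nose because `f` is surjective and onto in homology.
  have hy : L.d _ (c.next (c.prev j)) (y - f.f _ x) = 0 := by
    rw [c.next_eq' hij, map_sub, ← hom_d_apply, h, sub_self]
  obtain ⟨t, ht⟩ := L.exists_cycles _ hy
  obtain ⟨s, hs⟩ := (hq _).2 (L.homologyπ _ t)
  obtain ⟨w, -, hw⟩ := exists_cycles_of_surjective f hf s t hs
  refine ⟨x + K.iCycles _ w, ?_, ?_⟩
  · rw [map_add, d_iCycles_apply, add_zero]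
  · rw [map_add, ← iCycles_cyclesMap_apply, hw, ht, add_sub_cancel]

/-- A map lifting the solutions of the equations `d x = z` is surjective. -/
lemma surjective_of_exists_lift 
    (H : ∀ i (y : L.X i) (z : K.X (c.next i)), K.d _ (c.next (c.next i)) z = 0 →
      f.f _ z = L.d i _ y → ∃ x : K.X i, K.d i _ x = z ∧ f.f i x = y) (i : ι) :
    Function.Surjective (f.f i) := by
  have H' (i) (y : L.X i) (hy : L.d i (c.next i) y = 0) :
      ∃ x : K.X i, K.d i (c.next i) x = 0 ∧ f.f i x = y :=
    H i y 0 (map_zero _) (by rw [map_zero, hy])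
  intro y
  -- By `H'`, cycles lift to cycles. Lifting `d y` first produces the right-hand side of an equation
  -- whose solution lies over `y`.
  obtain ⟨z, hz, hz'⟩ := H' (c.next i) (L.d i _ y) (d_d_apply y)
  obtain ⟨x, -, hx⟩ := H i y z hz hz'
  exact ⟨x, hx⟩

/-- Injectivity in homology is the case where `z` is a cycle whose image bounds `y`; surjectivity is
the case `z = 0`. The relations with `next` and `prev` ensure that every degree is the target of a
differential. -/
lemma quasiIso_of_exists_lift (hc : ∀ i, c.Rel i (c.next i)) (hc' : ∀ i, c.Rel (c.prev i) i)
    (H : ∀ i (y : L.X i) (z : K.X (c.next i)), K.d _ (c.next (c.next i)) z = 0 →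
      f.f _ z = L.d i _ y → ∃ x : K.X i, K.d i _ x = z ∧ f.f i x = y) :
    QuasiIso f := by
  rw [quasiIso_iff_bijective]
  refine fun i => ⟨?_, ?_⟩
  · rw [injective_iff_map_eq_zero]
    intro h hh
    obtain ⟨z, rfl⟩ := K.homologyπ_surjective i h
    rw [homologyMap_homologyπ_apply] at hh
    obtain ⟨y, hy⟩ := L.exists_toCycles_eq _ hh
    obtain ⟨j, rfl⟩ : ∃ j, i = c.next j := ⟨_, (c.next_eq' (hc' i)).symm⟩
    have hj : c.prev (c.next j) = j := c.prev_eq' (hc j)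
    generalize c.prev (c.next j) = k at hj y
    subst hj
    obtain ⟨x, hx, -⟩ := H k y (K.iCycles _ z) (d_iCycles_apply _ _) (by
      rw [← iCycles_cyclesMap_apply, ← hy, iCycles_toCycles_apply])
    convert! K.homologyπ_toCycles_apply x
    apply K.iCycles_injective
    rw [iCycles_toCycles_apply, hx]
  · intro h
    obtain ⟨z, rfl⟩ := L.homologyπ_surjective i h
    obtain ⟨x, hx, hx'⟩ := H i (L.iCycles i z) 0 (map_zero _) (by
      rw [map_zero, d_iCycles_apply])
    obtain ⟨w, rfl⟩ := K.exists_cycles x hx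
    refine ⟨K.homologyπ i w, ?_⟩
    rw [homologyMap_homologyπ_apply]
    congr 1
    apply L.iCycles_injective
    rw [iCycles_cyclesMap_apply, hx']

/-- The map to homology induced by a map to the cycles. -/
noncomputable def classMap {A : ModuleCat.{u} R} (K : HomologicalComplex (ModuleCat.{u} R) c)
    {i : ι} (k : A ⟶ K.X i) (hk : k ≫ K.d i (c.next i) = 0) : A ⟶ K.homology i :=
  K.liftCycles k _ rfl hk ≫ K.homologyπ i

lemma classMap_homologyMap {A : ModuleCat.{u} R} {i : ι} (k : A ⟶ K.X i)
    (hk : k ≫ K.d i (c.next i) = 0) :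
    K.classMap k hk ≫ homologyMap f i = L.classMap (k ≫ f.f i)
      (by rw [Category.assoc, f.comm, reassoc_of% hk, zero_comp]) := by
  simp only [classMap, Category.assoc, homologyπ_naturality]
  rw [liftCycles_comp_cyclesMap_assoc]

/-- Projective modules lift through the cycles of a surjective map. -/
lemma exists_classMap_eq (hf : ∀ i, Function.Surjective (f.f i)) {V : ModuleCat.{u} R}
    [Projective V] {i : ι} (h : V ⟶ K.homology i) (k : V ⟶ L.X i)
    (hk : k ≫ L.d i (c.next i) = 0) (hh : h ≫ homologyMap f i = L.classMap k hk) :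
    ∃ (m : V ⟶ K.X i) (hm : m ≫ K.d i (c.next i) = 0), K.classMap m hm = h ∧ m ≫ f.f i = k := by
  -- `exists_cycles_of_surjective` says exactly that `t` is onto, so a map from a projective module
  -- to the pullback factors through the cycles of `K`.
  let t : K.cycles i ⟶ pullback (homologyMap f i) (L.homologyπ i) :=
    pullback.lift (K.homologyπ i) (cyclesMap f i) (homologyπ_naturality f i)
  have : Epi t := by
    rw [ModuleCat.epi_iff_surjective]
    intro x
    obtain ⟨w, hw, hw'⟩ := exists_cycles_of_surjective f hf
      (pullback.fst (homologyMap f i) (L.homologyπ i) x)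
      (pullback.snd (homologyMap f i) (L.homologyπ i) x)
      (by rw [← ConcreteCategory.comp_apply, pullback.condition, ConcreteCategory.comp_apply])
    refine ⟨w, ModuleCat.pullback_ext _ _ ?_ ?_⟩
    · rw [← hw, ← ConcreteCategory.comp_apply, pullback.lift_fst]
    · rw [← hw', ← ConcreteCategory.comp_apply, pullback.lift_snd]
  let g : V ⟶ pullback (homologyMap f i) (L.homologyπ i) :=
    pullback.lift h (L.liftCycles k _ rfl hk) hh
  let l := Projective.factorThru g t
  have hl : l ≫ t = g := Projective.factorThru_comp g t
  have h₁ : l ≫ K.homologyπ i = h := by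
    have := hl =≫ pullback.fst _ _
    rw [Category.assoc, pullback.lift_fst] at this
    exact this.trans (pullback.lift_fst _ _ _)
  have h₂ : l ≫ cyclesMap f i = L.liftCycles k _ rfl hk := by
    have := hl =≫ pullback.snd _ _
    rw [Category.assoc, pullback.lift_snd] at this
    exact this.trans (pullback.lift_snd _ _ _)
  refine ⟨l ≫ K.iCycles i, by simp, ?_, ?_⟩
  · rw [← h₁, classMap]
    congr 1
    rw [← cancel_mono (K.iCycles i), liftCycles_i]
  · simpa using h₂ =≫ L.iCycles i

end Elements

end HomologicalComplex

/-! ### Free and cofree complexes on graded objects, and their acyclicity. -/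

namespace HomologicalComplex

section FreeCofree

variable {C : Type*} [Category* C] [Preadditive C] [HasBinaryBiproducts C]
  {ι : Type*} [AddGroup ι] {a : ι}

/-- The cofree complex on a graded object. -/
noncomputable def cofree (a : ι) (M : ι → C) : HomologicalComplex C (ComplexShape.up' a) where
  X i := M i ⊞ M (i + a)
  d i j :=
    letI := Classical.propDecidable
    if h : i + a = j then biprod.snd ≫ eqToHom (congrArg M h) ≫ biprod.inl else 0
  shape i j h := dif_neg h
  d_comp_d' i j k hij hjk := by
    obtain rfl : i + a = j := hij
    obtain rfl : i + a + a = k := hjk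
    simp

/-- The components of a cofree complex. -/
noncomputable def cofreeXIso (M : ι → C) (i : ι) : (cofree a M).X i ≅ M i ⊞ M (i + a) := Iso.refl _

lemma cofree_d (M : ι → C) (i : ι) :
    (cofree a M).d i (i + a) =
      (cofreeXIso M i).hom ≫ biprod.snd ≫ biprod.inl ≫ (cofreeXIso M (i + a)).inv := by
  simp [cofree, cofreeXIso]

/-- The projection of the cofree complex on the graded object. -/
noncomputable def cofreeπ (M : ι → C) (i : ι) : (cofree a M).X i ⟶ M i :=
  (cofreeXIso M i).hom ≫ biprod.fst

/-- The morphism to a cofree complex induced by a morphism of graded objects. -/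
noncomputable def toCofree {K : HomologicalComplex C (ComplexShape.up' a)} {M : ι → C}
    (g : ∀ i, K.X i ⟶ M i) : K ⟶ cofree a M where
  f i := biprod.lift (g i) (K.d i (i + a) ≫ g (i + a)) ≫ (cofreeXIso M i).inv
  comm' i j hij := by
    obtain rfl : i + a = j := hij
    rw [cofree_d, ← Category.assoc _ _ (cofreeXIso M (i + a)).inv, ← Category.assoc,
      ← Category.assoc, ← Category.assoc, ← Category.assoc]
    congr 1
    apply biprod.hom_ext <;> simp

@[simp]
lemma toCofree_π {K : HomologicalComplex C (ComplexShape.up' a)} {M : ι → C}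
    (g : ∀ i, K.X i ⟶ M i) (i : ι) : (toCofree g).f i ≫ cofreeπ M i = g i := by
  simp [toCofree, cofreeπ]

/-- Commutation with `d` expresses the second coordinate of a map to a cofree complex through the
first coordinate one degree later. -/
lemma toCofree_ext {K : HomologicalComplex C (ComplexShape.up' a)} {M : ι → C}
    {f g : K ⟶ cofree a M} (h : ∀ i, f.f i ≫ cofreeπ M i = g.f i ≫ cofreeπ M i) : f = g := by
  ext i
  have H (k : K ⟶ cofree a M) : (k.f i ≫ (cofreeXIso M i).hom) ≫ biprod.snd =
      K.d i (i + a) ≫ k.f (i + a) ≫ cofreeπ M (i + a) := by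
    rw [← k.comm_assoc, cofree_d]
    simp [cofreeπ]
  rw [← cancel_mono (cofreeXIso M i).hom]
  apply biprod.hom_ext
  · simpa only [cofreeπ, Category.assoc] using h i
  · rw [H, H, h]

/-- The morphism of cofree complexes induced by a morphism of graded objects. -/
noncomputable def cofreeMap {M N : ι → C} (g : ∀ i, M i ⟶ N i) : cofree a M ⟶ cofree a N :=
  toCofree fun i => cofreeπ M i ≫ g i

@[simp]
lemma cofreeMap_π {M N : ι → C} (g : ∀ i, M i ⟶ N i) (i : ι) :
    (cofreeMap (a := a) g).f i ≫ cofreeπ N i = cofreeπ M i ≫ g i := by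
  simp [cofreeMap]

instance {M N : ι → C} (g : ∀ i, M i ⟶ N i) [∀ i, Epi (g i)] (i : ι) :
    Epi ((cofreeMap (a := a) g).f i) := by
  have : (cofreeMap (a := a) g).f i = (cofreeXIso M i).hom ≫
      biprod.map (g i) (g (i + a)) ≫ (cofreeXIso N i).inv := by
    rw [← cancel_mono (cofreeXIso N i).hom]
    apply biprod.hom_ext <;> simp [cofreeMap, toCofree, cofree_d, cofreeπ]
  rw [this]
  infer_instance

/-- The differential is `(x, y) ↦ (y, 0)`, so a cycle is of the form `(x, 0)` and is the boundary of
`(0, x)`. -/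
lemma cofree_exists_comp_d {M : ι → C} {i : ι} {A : C} (x : A ⟶ (cofree a M).X i)
    (hx : x ≫ (cofree a M).d i (i + a) = 0) : ∃ y, y ≫ (cofree a M).d (i - a) i = x := by
  obtain ⟨j, rfl⟩ : ∃ j, i = j + a := ⟨i - a, by simp⟩
  obtain hj : j + a - a = j := by simp
  rw [hj]
  refine ⟨x ≫ (cofreeXIso _ _).hom ≫ biprod.fst ≫ biprod.inr ≫ (cofreeXIso _ _).inv, ?_⟩
  have hx' : x ≫ (cofreeXIso _ _).hom ≫ biprod.snd = 0 := by
    rw [cofree_d] at hx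
    have := hx =≫ (cofreeXIso _ _).hom ≫ biprod.fst
    simpa using this
  rw [cofree_d, ← cancel_mono (cofreeXIso _ _).hom]
  apply biprod.hom_ext
  · simp
  · simp [hx']

/-- The free complex on a graded object. -/
noncomputable def free (a : ι) (M : ι → C) : HomologicalComplex C (ComplexShape.up' a) where
  X i := M (i - a) ⊞ M i
  d i j :=
    letI := Classical.propDecidable
    if h : i = j - a then biprod.snd ≫ eqToHom (congrArg M h) ≫ biprod.inl else 0
  shape i j h := dif_neg fun h' => h (by subst h'; exact sub_add_cancel _ _)
  d_comp_d' i j k hij hjk := by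
    obtain rfl : i = j - a := eq_sub_of_add_eq hij
    obtain rfl : j = k - a := eq_sub_of_add_eq hjk
    simp

/-- The components of a free complex. -/
noncomputable def freeXIso (M : ι → C) (i : ι) : (free a M).X i ≅ M (i - a) ⊞ M i := Iso.refl _

lemma free_d (M : ι → C) (j : ι) :
    (free a M).d (j - a) j =
      (freeXIso M (j - a)).hom ≫ biprod.snd ≫ biprod.inl ≫ (freeXIso M j).inv := by
  simp [free, freeXIso]

/-- The inclusion of the graded object in the free complex. -/
noncomputable def freeι (M : ι → C) (i : ι) : M i ⟶ (free a M).X i :=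
  biprod.inr ≫ (freeXIso M i).inv

/-- The morphism from a free complex induced by a morphism of graded objects. -/
noncomputable def ofFree {K : HomologicalComplex C (ComplexShape.up' a)} {M : ι → C}
    (g : ∀ i, M i ⟶ K.X i) : free a M ⟶ K where
  f i := (freeXIso M i).hom ≫ biprod.desc (g (i - a) ≫ K.d (i - a) i) (g i)
  comm' i j hij := by
    obtain rfl : i = j - a := eq_sub_of_add_eq hij
    rw [free_d, Category.assoc, Category.assoc]
    congr 1
    apply biprod.hom_ext' <;> simp

@[simp]
lemma ι_ofFree {K : HomologicalComplex C (ComplexShape.up' a)} {M : ι → C}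
    (g : ∀ i, M i ⟶ K.X i) (i : ι) : freeι M i ≫ (ofFree g).f i = g i := by
  simp [freeι, ofFree]

lemma ofFree_ext {K : HomologicalComplex C (ComplexShape.up' a)} {M : ι → C}
    {f g : free a M ⟶ K} (h : ∀ i, freeι M i ≫ f.f i = freeι M i ≫ g.f i) : f = g := by
  ext i
  have H (k : free a M ⟶ K) : biprod.inl ≫ (freeXIso M i).inv ≫ k.f i =
      freeι M (i - a) ≫ k.f (i - a) ≫ K.d (i - a) i := by
    rw [k.comm, free_d]
    simp [freeι]
  rw [← cancel_epi (freeXIso M i).inv]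
  apply biprod.hom_ext'
  · rw [H, H, reassoc_of% (h (i - a))]
  · simpa only [freeι, Category.assoc] using h i

instance {M : ι → C} [∀ i, Projective (M i)] (i : ι) : Projective ((free a M).X i) :=
  inferInstanceAs (Projective (M (i - a) ⊞ M i))

lemma free_exists_comp_d {M : ι → C} {i : ι} {A : C} (x : A ⟶ (free a M).X i)
    (hx : x ≫ (free a M).d i (i + a) = 0) : ∃ y, y ≫ (free a M).d (i - a) i = x := by
  refine ⟨x ≫ (freeXIso _ _).hom ≫ biprod.fst ≫ biprod.inr ≫ (freeXIso _ _).inv, ?_⟩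
  have hx' : x ≫ (freeXIso _ _).hom ≫ biprod.snd = 0 := by
    obtain ⟨j, hj⟩ : ∃ j, j = i + a := ⟨_, rfl⟩
    rw [← hj] at hx
    obtain rfl : i = j - a := by simp [hj]
    rw [free_d] at hx
    have := hx =≫ (freeXIso _ _).hom ≫ biprod.fst
    simpa using this
  rw [free_d, ← cancel_mono (freeXIso _ _).hom]
  apply biprod.hom_ext
  · simp
  · simp [hx']

end FreeCofree

section

variable {R : Type u} [CommRing R] {ι : Type*} [AddGroup ι] {a : ι}

lemma up'_next (i : ι) : (ComplexShape.up' a).next i = i + a :=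
  (ComplexShape.up' a).next_eq' rfl

lemma up'_prev (i : ι) : (ComplexShape.up' a).prev i = i - a :=
  (ComplexShape.up' a).prev_eq' (sub_add_cancel i a)

/-- A complex in which every cycle is a boundary has zero homology. -/
lemma isZero_homology_of_exists {K : HomologicalComplex (ModuleCat.{u} R) (ComplexShape.up' a)}
    (H : ∀ (i : ι) (A : ModuleCat.{u} R) (x : A ⟶ K.X i), x ≫ K.d i (i + a) = 0 →
      ∃ y, y ≫ K.d (i - a) i = x) (i : ι) : IsZero (K.homology i) := by
  -- Applied to the universal cycle, the hypothesis gives a section of `toCycles`, whence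
  -- `homologyπ` vanishes.
  obtain ⟨y, hy⟩ := H i _ (K.iCycles i) (K.iCycles_d _ _)
  have hy' : y ≫ K.toCycles _ i = 𝟙 _ := by
    rw [← cancel_mono (K.iCycles i), Category.assoc, toCycles_i, hy, Category.id_comp]
  rw [IsZero.iff_id_eq_zero, ← cancel_epi (K.homologyπ i), Category.comp_id, comp_zero,
    ← Category.id_comp (K.homologyπ i), ← hy', Category.assoc, toCycles_comp_homologyπ, comp_zero]

lemma isZero_homology_cofree (M : ι → ModuleCat.{u} R) (i : ι) :
    IsZero ((cofree a M).homology i) :=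
  isZero_homology_of_exists (fun _ _ => cofree_exists_comp_d) i

lemma isZero_homology_free (M : ι → ModuleCat.{u} R) (i : ι) :
    IsZero ((free a M).homology i) :=
  isZero_homology_of_exists (fun _ _ => free_exists_comp_d) i

instance (M : ι → ModuleCat.{u} R) (K : HomologicalComplex (ModuleCat.{u} R) (ComplexShape.up' a)) :
    QuasiIso (biprod.inl : K ⟶ K ⊞ free a M) := by
  have h (i) : homologyMap (biprod.snd : K ⊞ free a M ⟶ _) i = 0 :=
    (isZero_homology_free M i).eq_of_tgt _ _
  rw [quasiIso_iff]
  intro i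
  rw [quasiIsoAt_iff_isIso_homologyMap]
  refine ⟨homologyMap biprod.fst i, ?_, ?_⟩
  · rw [← homologyMap_comp, biprod.inl_fst, homologyMap_id]
  · rw [← homologyMap_comp, ← homologyMap_id, ← biprod.total, homologyMap_add, homologyMap_comp
      biprod.snd, h, zero_comp, add_zero]

instance {M N : ι → ModuleCat.{u} R} (g : ∀ i, M i ⟶ N i) :
    QuasiIso (cofreeMap (a := a) g) := by
  rw [quasiIso_iff]
  intro i
  rw [quasiIsoAt_iff_isIso_homologyMap]
  exact (isZero_homology_cofree M i).isIso (isZero_homology_cofree N i) _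

end

end HomologicalComplex

open ZeroObject

/-! ### Spheres, disks and the small object argument for complexes. -/

namespace HomologicalComplex

variable {R : Type u} [CommRing R] {a : ℤ × ℤ}

/-- The class of morphisms which are surjective in each degree. -/
def degreewiseSurjective (R : Type u) [CommRing R] (a : ℤ × ℤ) :
    MorphismProperty (HomologicalComplex (ModuleCat.{u} R) (ComplexShape.up' a)) :=
  fun _ _ f => ∀ i, Function.Surjective (f.f i)

/-- The class of quasi-isomorphisms which are surjective in each degree. -/
def surjectiveQuasiIso (R : Type u) [CommRing R] (a : ℤ × ℤ) :
    MorphismProperty (HomologicalComplex (ModuleCat.{u} R) (ComplexShape.up' a)) :=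
  fun _ _ f => degreewiseSurjective R a f ∧ QuasiIso f

lemma up'_rel (a i : ℤ × ℤ) : (ComplexShape.up' a).Rel i (i + a) := rfl

lemma up'_ne (ha : a ≠ 0) (i : ℤ × ℤ) : i ≠ i + a := by
  simpa using ha

variable (R) in
/-- The inclusion of the sphere in the disk. -/
noncomputable def sphereToDisk (ha : a ≠ 0) (i : ℤ × ℤ) :
    (single (ModuleCat.{u} R) (ComplexShape.up' a) (i + a)).obj (ModuleCat.of R R) ⟶
      double (𝟙 (ModuleCat.of R R)) (up'_rel a i) :=
  mkHomFromSingle (doubleXIso₁ _ _ (up'_ne ha i)).inv fun k _ => by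
    rw [double_d_eq_zero₀ _ _ _ _ (up'_ne ha i).symm, comp_zero]

variable (R) in
/-- The generating cofibrations of the category of complexes. -/
def generatingCofibrations (ha : a ≠ 0) :
    MorphismProperty (HomologicalComplex (ModuleCat.{u} R) (ComplexShape.up' a)) :=
  MorphismProperty.ofHoms (sphereToDisk R ha)

lemma sphereToDisk_f (ha : a ≠ 0) (i : ℤ × ℤ) :
    (sphereToDisk R ha i).f (i + a) = (singleObjXSelf (ComplexShape.up' a) (i + a) _).hom ≫
      (doubleXIso₁ _ _ (up'_ne ha i)).inv := by
  simp [sphereToDisk]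

lemma mono_sphereToDisk (ha : a ≠ 0) (i : ℤ × ℤ) : Mono (sphereToDisk R ha i) := by
  apply +allowSynthFailures mono_of_mono_f
  intro j
  by_cases hj : j = i + a
  · subst hj
    rw [sphereToDisk_f ha]
    infer_instance
  · exact (isZero_single_obj_X (ComplexShape.up' a) (i + a) _ j hj).mono _

/-- A square from `sphereToDisk` to `f` is a cycle `z` and an element `y` with `f z = d y`; a lift
is an `x` with `d x = z` and `f x = y`. The condition `a ≠ 0` keeps the two degrees of the disk
distinct. -/
lemma surjectiveQuasiIso_le_rlp (ha : a ≠ 0) :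
    surjectiveQuasiIso R a ≤ (generatingCofibrations R ha).rlp := by
  intro X Y f ⟨hf, hf'⟩ _ _ _ ⟨i⟩
  refine ⟨fun {u v} sq => ?_⟩
  have hi := up'_ne ha i
  let z := (singleObjXSelf (ComplexShape.up' a) (i + a) (ModuleCat.of R R)).inv ≫ u.f (i + a)
  let y := (doubleXIso₀ _ _).inv ≫ v.f i
  have hz (k) : z ≫ X.d (i + a) k = 0 := by
    dsimp [z]
    rw [Category.assoc, u.comm, single_obj_d, zero_comp, comp_zero]
  have hy : z ≫ f.f (i + a) = y ≫ Y.d i (i + a) := by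
    have := congr_hom sq.w (i + a)
    rw [comp_f, comp_f, sphereToDisk_f ha, Category.assoc, ← Iso.inv_comp_eq] at this
    simp [z, y, this, double_d _ _ hi]
  obtain ⟨x, hx, hx'⟩ := exists_lift_of_quasiIso f hf (up'_rel a i) (y (1 : R)) (z (1 : R))
    (ConcreteCategory.congr_hom (hz _) (1 : R))
      (ConcreteCategory.congr_hom hy (1 : R))
  let x' : ModuleCat.of R R ⟶ X.X i := ModuleCat.ofHom (LinearMap.toSpanSingleton R _ x)
  have h₁ : x' ≫ X.d i (i + a) = z := by
    ext
    simpa [x'] using hx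
  have h₂ : x' ≫ f.f i = y := by
    ext
    simpa [x'] using hx'
  refine ⟨⟨⟨mkHomFromDouble _ hi x' z (by rw [h₁, Category.id_comp]) fun k _ => hz k, ?_, ?_⟩⟩⟩
  · apply from_single_hom_ext
    rw [comp_f, sphereToDisk_f ha]
    simp [z]
  · apply from_double_hom_ext
    · simp [h₂, y]
    · rw [comp_f, mkHomFromDouble_f₁, Category.assoc, hy]
      simp [y, double_d _ _ hi]

lemma rlp_generatingCofibrations_le (ha : a ≠ 0) :
    (generatingCofibrations R ha).rlp ≤ surjectiveQuasiIso R a := by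
  intro X Y f hf
  have H (i : ℤ × ℤ) (y : Y.X i) (z : X.X ((ComplexShape.up' a).next i))
      (hz : X.d _ ((ComplexShape.up' a).next ((ComplexShape.up' a).next i)) z = 0)
      (hzy : f.f _ z = Y.d i _ y) :
      ∃ x : X.X i, X.d i _ x = z ∧ f.f i x = y := by
    have hi := up'_ne ha i
    generalize hj : (ComplexShape.up' a).next i = j at z hz hzy
    obtain rfl : i + a = j := (up'_next i).symm.trans hj
    let z' : ModuleCat.of R R ⟶ X.X (i + a) := ModuleCat.ofHom (LinearMap.toSpanSingleton R _ z)
    let y' : ModuleCat.of R R ⟶ Y.X i := ModuleCat.ofHom (LinearMap.toSpanSingleton R _ y)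
    have hz' (k) (hk : (ComplexShape.up' a).Rel (i + a) k) : z' ≫ X.d (i + a) k = 0 := by
      obtain rfl := (ComplexShape.up' a).next_eq' hk
      ext
      simpa [z'] using hz
    have hy' : z' ≫ f.f (i + a) = y' ≫ Y.d i (i + a) := by
      ext
      simpa [z', y'] using hzy
    have := hf _ ⟨i⟩
    have sq : CommSq (mkHomFromSingle z' hz') (sphereToDisk R ha i) f
        (mkHomFromDouble _ hi y' (y' ≫ Y.d i (i + a)) (by simp) (by simp)) := by
      constructor
      apply from_single_hom_ext
      rw [comp_f, comp_f, sphereToDisk_f ha]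
      simp [hy']
    have h₁ := congr_hom sq.fac_left (i + a)
    have h₂ := congr_hom sq.fac_right i
    rw [comp_f, sphereToDisk_f ha, mkHomFromSingle_f, Category.assoc, cancel_epi] at h₁
    rw [comp_f, mkHomFromDouble_f₀] at h₂
    refine ⟨sq.lift.f i ((doubleXIso₀ (𝟙 (ModuleCat.of R R))
      (up'_rel a i)).inv (1 : R)), ?_, ?_⟩
    · rw [← hom_d_apply]
      have := ConcreteCategory.congr_hom h₁ (1 : R)
      have e : (doubleXIso₀ (𝟙 (ModuleCat.of R R)) (up'_rel a i)).inv ≫ (double (𝟙 _) _).d i (i + a) =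
          (doubleXIso₁ _ _ hi).inv := by
        simp [double_d _ _ hi]
      have e' := ConcreteCategory.congr_hom e (1 : R)
      rw [ConcreteCategory.comp_apply] at e'
      rw [e']
      simpa [z'] using this
    · rw [← Iso.inv_comp_eq] at h₂
      simpa [y'] using ConcreteCategory.congr_hom h₂ (1 : R)
  exact ⟨surjective_of_exists_lift f H, quasiIso_of_exists_lift f
    (fun i => by rw [up'_next]; rfl) (fun i => by rw [up'_prev]; exact sub_add_cancel i a) H⟩

lemma hasNoLoop_up' (ha : a ≠ 0) : (ComplexShape.up' a).HasNoLoop where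
  not_rel_self i h := up'_ne ha i h.symm

open MorphismProperty in
lemma hasSmallObjectArgument_generatingCofibrations (ha : a ≠ 0) :
    HasSmallObjectArgument.{u} (generatingCofibrations R ha) := by
  have := hasNoLoop_up' ha
  have : IsGrothendieckAbelian.{u}
    (HomologicalComplex (ModuleCat.{u} R) (ComplexShape.up' a)) := inferInstance
  have : (monomorphisms (HomologicalComplex (ModuleCat.{u} R)
    (ComplexShape.up' a))).IsStableUnderCoproducts.{u} := inferInstance
  let S (i : ℤ × ℤ) := (single (ModuleCat.{u} R) (ComplexShape.up' a) (i + a)).obj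
    (ModuleCat.of R R)
  -- With `κ` larger than the number of subobjects of each sphere, maps out of spheres commute with
  -- the `κ`-indexed colimits of monomorphisms that occur in the cell attachments.
  obtain ⟨κ, hκ', hκ⟩ := HasCardinalLT.exists_regular_cardinal_forall.{u}
    (fun i => Subobject (S i))
  have : Fact κ.IsRegular := ⟨hκ'⟩
  have : Nonempty κ.ord.ToType := by simpa using hκ'.ne_zero
  have := WellFoundedLT.toOrderBot κ.ord.ToType
  exact ⟨κ, inferInstance, inferInstance,
    { isSmall := by
        exact MorphismProperty.isSmall_ofHoms _
      preservesColimit {A B X Y} i hi f hf := by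
        let hf' : (monomorphisms _).TransfiniteCompositionOfShape κ.ord.ToType f :=
          { toTransfiniteCompositionOfShape := hf.toTransfiniteCompositionOfShape
            map_mem j hj := by
              have := (hf.attachCells j hj).pushouts_coproducts
              simp only [ofHoms_homFamily] at this
              refine (?_ : _ ≤ monomorphisms _) _ this
              simp only [pushouts_le_iff, coproducts_le_iff]
              intro _ _ _ ⟨i⟩
              exact mono_sphereToDisk ha i }
        have (j j' : κ.ord.ToType) (φ : j ⟶ j') : Mono (hf'.F.map φ) := hf'.mem_map φ
        obtain ⟨i⟩ := hi
        exact IsGrothendieckAbelian.preservesColimit_coyoneda_obj_of_mono (Y := hf'.F) (hκ i) }⟩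

/-- Every morphism of complexes of modules factors as a morphism with the left lifting property
with respect to surjective quasi-isomorphisms, followed by a surjective quasi-isomorphism. -/
lemma exists_factorization_surjectiveQuasiIso (ha : a ≠ 0)
    {X Y : HomologicalComplex (ModuleCat.{u} R) (ComplexShape.up' a)} (f : X ⟶ Y) :
    ∃ (Z : HomologicalComplex (ModuleCat.{u} R) (ComplexShape.up' a)) (i : X ⟶ Z) (p : Z ⟶ Y),
      i ≫ p = f ∧ (surjectiveQuasiIso R a).llp i ∧ surjectiveQuasiIso R a p := by
  have := hasSmallObjectArgument_generatingCofibrations (R := R) ha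
  let d := MorphismProperty.factorizationData (generatingCofibrations R ha).rlp.llp
    (generatingCofibrations R ha).rlp f
  exact ⟨d.Z, d.i, d.p, d.fac,
    MorphismProperty.antitone_llp (surjectiveQuasiIso_le_rlp ha) _ d.hi,
    rlp_generatingCofibrations_le ha _ d.hp⟩

end HomologicalComplex

/-! ### Split inclusions with projective complement. -/

/-- Morphisms of modules which identify to the inclusion of a direct factor with a projective
complement. -/
def ModuleCat.IsSplitWithProjectiveComplement {R : Type u} [CommRing R] {M N : ModuleCat.{u} R}
    (i : M ⟶ N) : Prop :=
  ∃ (V : ModuleCat.{u} R) (_ : Projective V) (e : M ⊞ V ≅ N), biprod.inl ≫ e.hom = i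

lemma ModuleCat.isSplitWithProjectiveComplement_of_hasLiftingProperty {R : Type u} [CommRing R]
    {M N : ModuleCat.{u} R} (i : M ⟶ N)
    (hi : ∀ (A B : ModuleCat.{u} R) (p : A ⟶ B) [Epi p], HasLiftingProperty i p) :
    IsSplitWithProjectiveComplement i := by
  -- Lifting against `M ⟶ 0` gives a retraction; lifting against epimorphisms with zero top map will
  -- show that the cokernel is projective.
  have := hi M 0 0
  have sq : CommSq (𝟙 M) i (0 : M ⟶ (0 : ModuleCat R)) 0 := ⟨by simp⟩
  have : IsSplitMono i := ⟨⟨⟨sq.lift, sq.fac_left⟩⟩⟩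
  have hp : Projective (cokernel i) := by
    refine ⟨fun {A B} f p _ => ?_⟩
    have := hi _ _ p
    have sq : CommSq 0 i p (cokernel.π i ≫ f) := ⟨by simp⟩
    refine ⟨cokernel.desc i sq.lift sq.fac_left, ?_⟩
    rw [← cancel_epi (cokernel.π i)]
    simp
  let S := ShortComplex.mk i (cokernel.π i) (cokernel.condition i)
  let s : S.Splitting := ShortComplex.Splitting.ofExactOfRetraction S
    (ShortComplex.exact_cokernel i) (retraction i) (by simp [S]) (by dsimp [S]; infer_instance)
  refine ⟨cokernel i, hp, s.isoBinaryBiproduct.symm, ?_⟩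
  simp [S]

namespace HomologicalComplex

variable {R : Type u} [CommRing R] {a : ℤ × ℤ}

/-- Cofree complexes are acyclic, so an epimorphism of modules induces a surjective
quasi-isomorphism between them. Since maps to a cofree complex are graded maps, lifting against it
yields lifting for `f.f i` against the epimorphism. -/
lemma isSplitWithProjectiveComplement_of_llp
    {X Y : HomologicalComplex (ModuleCat.{u} R) (ComplexShape.up' a)} (f : X ⟶ Y)
    (hf : (surjectiveQuasiIso R a).llp f) (i : ℤ × ℤ) :
    ModuleCat.IsSplitWithProjectiveComplement (f.f i) := by
  apply ModuleCat.isSplitWithProjectiveComplement_of_hasLiftingProperty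
  intro A B p _
  refine ⟨fun {u v} sq => ?_⟩
  classical
  have : HasLiftingProperty f (cofreeMap (a := a) (fun _ : ℤ × ℤ => p)) :=
    hf _ ⟨fun j => (ModuleCat.epi_iff_surjective _).1 inferInstance, inferInstance⟩
  have sq' : CommSq
      (toCofree fun j => if h : j = i then eqToHom (by rw [h]) ≫ u else 0) f
      (cofreeMap (a := a) (fun _ : ℤ × ℤ => p))
      (toCofree fun j => if h : j = i then eqToHom (by rw [h]) ≫ v else 0) := by
    constructor
    apply toCofree_ext
    intro j
    by_cases h : j = i
    · subst h
      simp [reassoc_of% @toCofree_π, sq.w]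
    · simp [reassoc_of% @toCofree_π, h]
  refine ⟨⟨sq'.lift.f i ≫ cofreeπ _ i, ?_, ?_⟩⟩
  · rw [← comp_f_assoc, sq'.fac_left]
    simp
  · rw [Category.assoc, ← cofreeMap_π (a := a) (fun _ : ℤ × ℤ => p), ← comp_f_assoc,
      sq'.fac_right]
    simp

end HomologicalComplex

/-! ### Complexes with zero differential. -/

namespace HomologicalComplex

section

variable {C : Type*} [Category* C] [HasZeroMorphisms C] {ι : Type*} (c : ComplexShape ι)

/-- The complex with zero differential on a graded object. -/
def zeroDifferential (V : ι → C) : HomologicalComplex C c where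
  X := V
  d _ _ := 0

variable {c} {V : ι → C} {K : HomologicalComplex C c}

/-- Morphisms from a complex with zero differential. -/
def ofZeroDifferential (g : ∀ i, V i ⟶ K.X i) (hg : ∀ i, g i ≫ K.d i (c.next i) = 0) :
    zeroDifferential c V ⟶ K where
  f := g
  comm' i j hij := by
    obtain rfl := c.next_eq' hij
    simp [zeroDifferential, hg]

/-- The inclusion of the graded object in the complex with zero differential. -/
def zeroDifferentialι (V : ι → C) (i : ι) : V i ⟶ (zeroDifferential c V).X i := 𝟙 _

@[simp]
lemma zeroDifferential_d (i j : ι) : (zeroDifferential c V).d i j = 0 := rfl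

@[simp]
lemma ι_ofZeroDifferential (g : ∀ i, V i ⟶ K.X i) (hg : ∀ i, g i ≫ K.d i (c.next i) = 0) (i : ι) :
    zeroDifferentialι V i ≫ (ofZeroDifferential g hg).f i = g i :=
  Category.id_comp _

lemma ofZeroDifferential_ext {f g : zeroDifferential c V ⟶ K}
    (h : ∀ i, zeroDifferentialι V i ≫ f.f i = zeroDifferentialι V i ≫ g.f i) : f = g := by
  ext i
  have := h i
  erw [Category.id_comp, Category.id_comp] at this
  exact this

end

lemma exists_classMap {R : Type u} [CommRing R] {ι : Type*} {c : ComplexShape ι}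
    (K : HomologicalComplex (ModuleCat.{u} R) c) {V : ModuleCat.{u} R} [Projective V] {i : ι}
    (h : V ⟶ K.homology i) :
    ∃ (m : V ⟶ K.X i) (hm : m ≫ K.d i (c.next i) = 0), K.classMap m hm = h := by
  refine ⟨Projective.factorThru h (K.homologyπ i) ≫ K.iCycles i, by simp, ?_⟩
  conv_rhs => rw [← Projective.factorThru_comp h (K.homologyπ i)]
  rw [classMap]
  congr 1
  rw [← cancel_mono (K.iCycles i), liftCycles_i]

end HomologicalComplex

/-! ### Towers of pages with arbitrary bidegrees, stable under removal of the first page. -/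

/-- Variant of extended spectral sequences where the bidegree of the differential of the `s`-th
page is `a s`. -/
structure PageTower (R : Type u) [CommRing R] (a : ℕ → ℤ × ℤ) where
  /-- the pages -/
  page (s : ℕ) : HomologicalComplex (ModuleCat.{u} R) (ComplexShape.up' (a s))
  /-- the characteristic maps -/
  char (s : ℕ) (pn : ℤ × ℤ) : (page (s + 1)).X pn ⟶ (page s).homology pn

namespace PageTower

open HomologicalComplex

variable {R : Type u} [CommRing R] {a : ℕ → ℤ × ℤ}

/-- Morphisms of towers of pages. -/
@[ext]
structure Hom (X Y : PageTower R a) where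
  /-- the component on the `s`-th page -/
  hom (s : ℕ) : X.page s ⟶ Y.page s
  comm (s : ℕ) (pn : ℤ × ℤ) :
    X.char s pn ≫ homologyMap (hom s) pn = (hom (s + 1)).f pn ≫ Y.char s pn

instance : Category (PageTower R a) where
  Hom := Hom
  id X :=
    { hom := fun s => 𝟙 (X.page s)
      comm := by intro s pn; simp }
  comp f g :=
    { hom := fun s => f.hom s ≫ g.hom s
      comm := by
        intro s pn
        rw [homologyMap_comp, ← Category.assoc, f.comm, Category.assoc, g.comm, comp_f,
          Category.assoc] }

@[ext]
lemma hom_ext {X Y : PageTower R a} {f g : X ⟶ Y} (h : ∀ s, f.hom s = g.hom s) : f = g :=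
  Hom.ext (funext h)

@[simp]
lemma comp_hom {X Y Z : PageTower R a} (f : X ⟶ Y) (g : Y ⟶ Z) (s : ℕ) :
    (f ≫ g).hom s = f.hom s ≫ g.hom s := rfl

/-- The tower obtained by removing the first page. -/
def tail (X : PageTower R a) : PageTower R (fun s => a (s + 1)) where
  page s := X.page (s + 1)
  char s := X.char (s + 1)

/-- The morphism obtained by removing the first page. -/
def tailMap {X Y : PageTower R a} (f : X ⟶ Y) : X.tail ⟶ Y.tail where
  hom s := f.hom (s + 1)
  comm s := f.comm (s + 1)

/-- The first characteristic map, as a map from the first page of the tail. -/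
def headChar (X : PageTower R a) (pn : ℤ × ℤ) : (X.tail.page 0).X pn ⟶ (X.page 0).homology pn :=
  X.char 0 pn

lemma headChar_comm {X Y : PageTower R a} (f : X ⟶ Y) (pn : ℤ × ℤ) :
    X.headChar pn ≫ homologyMap (f.hom 0) pn = ((tailMap f).hom 0).f pn ≫ Y.headChar pn :=
  f.comm 0 pn

/-- The tower obtained by adding a first page. -/
def cons (P : HomologicalComplex (ModuleCat.{u} R) (ComplexShape.up' (a 0)))
    (T : PageTower R (fun s => a (s + 1))) (φ : ∀ pn, (T.page 0).X pn ⟶ P.homology pn) :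
    PageTower R a where
  page s := match s with
    | 0 => P
    | s + 1 => T.page s
  char s := match s with
    | 0 => φ
    | s + 1 => T.char s

/-- Constructor for morphisms, from the first component and the other components. -/
def consHom {X Y : PageTower R a} (f : X.page 0 ⟶ Y.page 0) (g : X.tail ⟶ Y.tail)
    (comm : ∀ pn, X.headChar pn ≫ homologyMap f pn = (g.hom 0).f pn ≫ Y.headChar pn) : X ⟶ Y where
  hom s := match s with
    | 0 => f
    | s + 1 => g.hom s
  comm s := match s with
    | 0 => comm
    | s + 1 => g.comm s

/-- Given a morphism `f : X ⟶ Y` and a factorization of `f` on all pages but the first, through a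
morphism which is split with projective complement on the first remaining page, a factorization
of `f` whose second morphism is surjective on the first page. -/
lemma exists_cons_factorization {X Y : PageTower R a} (f : X ⟶ Y)
    (T : PageTower R (fun s => a (s + 1))) (i' : X.tail ⟶ T) (p' : T ⟶ Y.tail)
    (fac : i' ≫ p' = tailMap f)
    (hi' : ∀ j, ModuleCat.IsSplitWithProjectiveComplement ((i'.hom 0).f j)) :
    ∃ (P : HomologicalComplex (ModuleCat.{u} R) (ComplexShape.up' (a 0)))
      (φ : ∀ pn, (T.page 0).X pn ⟶ P.homology pn) (i : X ⟶ cons P T φ) (p : cons P T φ ⟶ Y),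
      tailMap i = i' ∧ tailMap p = p' ∧ i ≫ p = f ∧
      (∀ j, Function.Surjective ((p.hom 0).f j)) ∧
      (∀ j, ModuleCat.IsSplitWithProjectiveComplement ((i.hom 0).f j)) ∧
      ∀ {A B : PageTower R a} (q : A ⟶ B), (∀ j, Function.Surjective ((q.hom 0).f j)) →
        HasLiftingProperty i' (tailMap q) → HasLiftingProperty i q := by
  choose V hV e he using hi'
  -- The cycles `n j` represent the homology classes that `V j` must hit in `Y`; they define `p₀` on
  -- `VV`.
  choose n hn hn' using fun j => (Y.page 0).exists_classMap
    (biprod.inr ≫ (e j).hom ≫ (p'.hom 0).f j ≫ Y.headChar j)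
  let VV : HomologicalComplex (ModuleCat.{u} R) (ComplexShape.up' (a 0)) :=
    zeroDifferential _ V
  let F : HomologicalComplex (ModuleCat.{u} R) (ComplexShape.up' (a 0)) :=
    free (a 0) (fun j => Projective.over ((Y.page 0).X j))
  let P := X.page 0 ⊞ (VV ⊞ F)
  let iV : VV ⟶ P := biprod.inl ≫ biprod.inr
  let iF : F ⟶ P := biprod.inr ≫ biprod.inr
  let v (j) : V j ⟶ P.X j := zeroDifferentialι V j ≫ iV.f j
  have hv (j) : v j ≫ P.d j ((ComplexShape.up' (a 0)).next j) = 0 := by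
    dsimp only [v]
    rw [Category.assoc, iV.comm, zeroDifferential_d, zero_comp, comp_zero]
  -- Under `T_0 ≅ X_1 ⊕ V`, the first summand keeps its characteristic map and `V j` goes to its own
  -- tautological class.
  let φ (j) : (T.page 0).X j ⟶ P.homology j :=
    (e j).inv ≫ biprod.desc (X.headChar j ≫ homologyMap biprod.inl j) (P.classMap (v j) (hv j))
  have hφ {A : PageTower R a} (ℓ : P ⟶ A.page 0) (ℓ' : T ⟶ A.tail)
      (h₁ : ∀ j, X.headChar j ≫ homologyMap (biprod.inl ≫ ℓ) j =
        (i'.hom 0).f j ≫ (ℓ'.hom 0).f j ≫ A.headChar j)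
      (h₂ : ∀ j, (A.page 0).classMap (v j ≫ ℓ.f j)
        (by rw [Category.assoc, ℓ.comm, reassoc_of% hv j, zero_comp]) =
          biprod.inr ≫ (e j).hom ≫ (ℓ'.hom 0).f j ≫ A.headChar j) (j) :
      φ j ≫ homologyMap ℓ j = (ℓ'.hom 0).f j ≫ A.headChar j := by
    dsimp only [φ]
    rw [Category.assoc, Iso.inv_comp_eq]
    apply biprod.hom_ext'
    · rw [biprod.inl_desc_assoc, Category.assoc, ← homologyMap_comp, h₁, ← he, Category.assoc]
    · rw [biprod.inr_desc_assoc, classMap_homologyMap, h₂]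
  let i : X ⟶ cons P T φ := consHom (biprod.inl : X.page 0 ⟶ P) i' (fun j => by
    change _ = _ ≫ φ j
    dsimp only [φ]
    rw [← he, Category.assoc, Iso.hom_inv_id_assoc, biprod.inl_desc]
    rfl)
  let ιF (j) : Projective.over ((Y.page 0).X j) ⟶ F.X j :=
    freeι (fun j => Projective.over ((Y.page 0).X j)) j
  let p₀ : P ⟶ Y.page 0 := biprod.desc (f.hom 0)
    (biprod.desc (ofZeroDifferential n hn) (ofFree (fun j => Projective.π _)))
  have hp₀ : iF ≫ p₀ = ofFree (fun j => Projective.π _) := by simp [iF, p₀]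
  let p : cons P T φ ⟶ Y := consHom p₀ p' (hφ p₀ p' (fun j => by
      rw [biprod.inl_desc, headChar_comm, ← Category.assoc, ← comp_f, ← comp_hom, fac]) (fun j => by
      rw [← hn']
      congr 1
      simp only [v, iV, p₀, Category.assoc, ← comp_f]
      simp))
  refine ⟨P, φ, i, p, rfl, rfl, ?_, ?_, ?_, ?_⟩
  · ext1 s
    cases s with
    | zero => exact biprod.inl_desc _ _
    | succ s => exact congr_arg (fun g => g.hom s) fac
  · intro j
    rw [← ModuleCat.epi_iff_surjective]
    have : Epi ((freeι _ j ≫ iF.f j) ≫ p₀.f j) := by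
      rw [Category.assoc, ← comp_f, hp₀, ι_ofFree]
      infer_instance
    exact epi_of_epi (freeι _ j ≫ iF.f j) (p₀.f j)
  · intro j
    have : Projective (VV.X j) := hV j
    have : Projective (F.X j) := inferInstanceAs (Projective ((free (a 0) _).X j))
    have : Projective ((VV ⊞ F).X j) := Projective.of_iso (biprodXIso VV F j).symm inferInstance
    exact ⟨(VV ⊞ F).X j, this, (biprodXIso (X.page 0) (VV ⊞ F) j).symm,
      inl_biprodXIso_inv _ _ _⟩
  · intro A B q hq hi
    refine ⟨fun {u w} sq => ?_⟩
    let w' : T ⟶ B.tail := tailMap w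
    have sq' : CommSq (tailMap u) i' (tailMap q) w' :=
      ⟨congr_arg tailMap sq.w⟩
    let ℓ' := sq'.lift
    have hℓ : ℓ' ≫ tailMap q = w' := sq'.fac_right
    have hℓ' : i' ≫ ℓ' = tailMap u := sq'.fac_left
    have hw₀ : u.hom 0 ≫ q.hom 0 = biprod.inl ≫ w.hom 0 :=
      congr_arg (fun g => g.hom 0) sq.w
    let w₀ : P ⟶ B.page 0 := w.hom 0
    -- The lift on the tail is already fixed. It prescribes the class of the cycles `m j` in `A`,
    -- while `w` prescribes their image in `B`; the two agree because `w` commutes with the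
    -- characteristic maps.
    choose m hm hm' hm'' using fun j => exists_classMap_eq (q.hom 0) hq
      (biprod.inr ≫ (e j).hom ≫ (ℓ'.hom 0).f j ≫ A.headChar j)
      (v j ≫ w₀.f j) (by rw [Category.assoc, w₀.comm, reassoc_of% hv j, zero_comp]) (by
        rw [← classMap_homologyMap _ _ (hv j)]
        have h : φ j ≫ homologyMap w₀ j = (w'.hom 0).f j ≫ B.headChar j := headChar_comm w j
        dsimp only [φ] at h
        rw [Category.assoc, Iso.inv_comp_eq] at h
        have h' := biprod.inr ≫= h
        rw [biprod.inr_desc_assoc] at h'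
        rw [h', ← hℓ, comp_hom, comp_f]
        simp only [Category.assoc]
        rw [headChar_comm])
    have (j : ℤ × ℤ) : Epi ((q.hom 0).f j) := (ModuleCat.epi_iff_surjective _).2 (hq j)
    let ℓ₀ : P ⟶ A.page 0 := biprod.desc (u.hom 0) (biprod.desc (ofZeroDifferential m hm)
      (ofFree (fun j => Projective.factorThru (ιF j ≫ iF.f j ≫ w₀.f j) ((q.hom 0).f j))))
    let ℓ : cons P T φ ⟶ A := consHom ℓ₀ ℓ' (hφ ℓ₀ ℓ' (fun j => by
      rw [biprod.inl_desc, headChar_comm, ← hℓ', comp_hom, comp_f, Category.assoc]) (fun j => by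
        rw [← hm']
        congr 1
        simp only [v, iV, ℓ₀, Category.assoc, ← comp_f]
        simp))
    refine ⟨⟨ℓ, ?_, ?_⟩⟩
    · ext1 s
      cases s with
      | zero => exact biprod.inl_desc _ _
      | succ s => exact congr_arg (fun g => g.hom s) hℓ'
    · ext1 s
      cases s with
      | zero =>
        change ℓ₀ ≫ q.hom 0 = w₀
        apply biprod.hom_ext'
        · rw [biprod.inl_desc_assoc, hw₀]
        · apply biprod.hom_ext'
          · rw [biprod.inr_desc_assoc, biprod.inl_desc_assoc]
            apply ofZeroDifferential_ext
            intro j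
            rw [comp_f, reassoc_of% @ι_ofZeroDifferential, hm'']
            simp only [v, iV, Category.assoc, comp_f]
          · rw [biprod.inr_desc_assoc, biprod.inr_desc_assoc]
            apply ofFree_ext
            intro j
            rw [comp_f, reassoc_of% @ι_ofFree, Projective.factorThru_comp]
            simp only [ιF, iF, Category.assoc, comp_f]
      | succ s => exact congr_arg (fun g => g.hom s) hℓ

end PageTower

/-! ### Factorizations of towers, by induction on `r`. -/

namespace PageTower

open HomologicalComplex

variable {R : Type u} [CommRing R] {a : ℕ → ℤ × ℤ}

/-- A factorization of a morphism on the first page gives a factorization of the morphism,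
whose first component is an isomorphism on the other pages. -/
lemma exists_factorization_of_head {X Y : PageTower R a} (f : X ⟶ Y)
    (W : HomologicalComplex (ModuleCat.{u} R) (ComplexShape.up' (a 0)))
    (i₀ : X.page 0 ⟶ W) (p₀ : W ⟶ Y.page 0) (fac : i₀ ≫ p₀ = f.hom 0) :
    ∃ (φ : ∀ pn, (X.tail.page 0).X pn ⟶ W.homology pn) (i : X ⟶ cons W X.tail φ)
      (p : cons W X.tail φ ⟶ Y),
      i.hom 0 = i₀ ∧ tailMap i = 𝟙 _ ∧ p.hom 0 = p₀ ∧ i ≫ p = f ∧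
      ∀ {A B : PageTower R a} (q : A ⟶ B), HasLiftingProperty i₀ (q.hom 0) →
        HasLiftingProperty i q := by
  -- The later pages of `X` are kept, so a lift there is dictated by the top map of the square, and
  -- only page 0 poses a lifting problem.
  let φ (pn) : (X.tail.page 0).X pn ⟶ W.homology pn := X.headChar pn ≫ homologyMap i₀ pn
  have hφ {A : PageTower R a} (ℓ : W ⟶ A.page 0) (g : X ⟶ A) (h : i₀ ≫ ℓ = g.hom 0) (pn) :
      φ pn ≫ homologyMap ℓ pn = ((tailMap g).hom 0).f pn ≫ A.headChar pn := by
    rw [← headChar_comm, ← h, homologyMap_comp]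
    exact Category.assoc _ _ _
  let i : X ⟶ cons W X.tail φ := consHom i₀ (𝟙 _) (fun pn => (Category.id_comp _).symm)
  let f' : X.tail ⟶ Y.tail := tailMap f
  let p : cons W X.tail φ ⟶ Y := consHom p₀ f' (hφ p₀ f fac)
  refine ⟨φ, i, p, rfl, rfl, rfl, ?_, ?_⟩
  · ext1 s
    cases s with
    | zero => exact fac
    | succ s => exact Category.id_comp (f.hom (s + 1))
  · intro A B q hq
    refine ⟨fun {u w} sq => ?_⟩
    let w₀ : W ⟶ B.page 0 := w.hom 0
    let u' : X.tail ⟶ A.tail := tailMap u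
    have sq₀ : CommSq (u.hom 0) i₀ (q.hom 0) w₀ := ⟨congr_arg (fun g => g.hom 0) sq.w⟩
    let ℓ : cons W X.tail φ ⟶ A := consHom sq₀.lift u' (hφ sq₀.lift u sq₀.fac_left)
    refine ⟨⟨ℓ, ?_, ?_⟩⟩
    · ext1 s
      cases s with
      | zero => exact sq₀.fac_left
      | succ s => exact Category.id_comp (u.hom (s + 1))
    · ext1 s
      cases s with
      | zero => exact sq₀.fac_right
      | succ s =>
        exact (congr_arg (fun g => g.hom (s + 1)) sq.w).trans (Category.id_comp (w.hom (s + 1)))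

/-- The class of morphisms which are surjective on all pages up to the `r`-th. -/
def Surjective (r : ℕ) {X Y : PageTower R a} (f : X ⟶ Y) : Prop :=
  ∀ s ≤ r, ∀ pn, Function.Surjective ((f.hom s).f pn)

lemma Surjective.tail {r : ℕ} {X Y : PageTower R a} {f : X ⟶ Y} (hf : Surjective (r + 1) f) :
    Surjective r (tailMap f) :=
  fun s hs => hf (s + 1) (Nat.succ_le_succ hs)

lemma surjective_succ {r : ℕ} {X Y : PageTower R a} {f : X ⟶ Y}
    (h₀ : ∀ pn, Function.Surjective ((f.hom 0).f pn)) (hf : Surjective r (tailMap f)) :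
    Surjective (r + 1) f
  | 0, _ => h₀
  | s + 1, hs => hf s (Nat.le_of_succ_le_succ hs)

/-- The splitting of page 0 is not wanted for itself: it is the input of `exists_cons_factorization`
when another page is put in front. -/
lemma exists_factorization_surjectiveQuasiIso (r : ℕ) {a : ℕ → ℤ × ℤ} (ha : ∀ s, a s ≠ 0)
    {X Y : PageTower R a} (f : X ⟶ Y) :
    ∃ (Z : PageTower R a) (i : X ⟶ Z) (p : Z ⟶ Y), i ≫ p = f ∧
      (∀ j, ModuleCat.IsSplitWithProjectiveComplement ((i.hom 0).f j)) ∧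
      Surjective r p ∧ QuasiIso (p.hom r) ∧
      ∀ {A B : PageTower R a} (q : A ⟶ B), Surjective r q → QuasiIso (q.hom r) →
        HasLiftingProperty i q := by
  induction r generalizing a with
  | zero =>
    obtain ⟨W, i₀, p₀, fac, hi₀, hp₀⟩ :=
      HomologicalComplex.exists_factorization_surjectiveQuasiIso (ha 0) (f.hom 0)
    obtain ⟨φ, i, p, hi, -, hp, fac', H⟩ := exists_factorization_of_head f W i₀ p₀ fac
    refine ⟨_, i, p, fac', ?_, ?_, ?_, fun q hq hq' => H q (hi₀ _ ⟨hq 0 le_rfl, hq'⟩)⟩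
    · rw [hi]
      exact isSplitWithProjectiveComplement_of_llp i₀ hi₀
    · intro s hs
      obtain rfl := Nat.le_zero.1 hs
      rw [hp]
      exact hp₀.1
    · rw [hp]
      exact hp₀.2
  | succ r hr =>
    obtain ⟨T, i', p', fac, hi', hp', hp'', H⟩ := hr (fun s => ha (s + 1)) (tailMap f)
    obtain ⟨P, φ, i, p, hi, hp, fac', h₁, h₂, h₃⟩ := exists_cons_factorization f T i' p' fac hi'
    refine ⟨_, i, p, fac', h₂, surjective_succ h₁ ?_, ?_, fun q hq hq' =>
      h₃ q (hq 0 (Nat.zero_le _)) (H _ hq.tail hq')⟩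
    · rwa [hp]
    · rw [← hp] at hp''
      exact hp''

lemma exists_factorization_surjective (r : ℕ) {a : ℕ → ℤ × ℤ} {X Y : PageTower R a} (f : X ⟶ Y) :
    ∃ (Z : PageTower R a) (i : X ⟶ Z) (p : Z ⟶ Y), i ≫ p = f ∧
      (∀ j, ModuleCat.IsSplitWithProjectiveComplement ((i.hom 0).f j)) ∧
      QuasiIso (i.hom r) ∧ (∀ s, r < s → IsIso (i.hom s)) ∧ Surjective r p ∧
      ∀ {A B : PageTower R a} (q : A ⟶ B), Surjective r q → HasLiftingProperty i q := by
  induction r generalizing a with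
  | zero =>
    let F : HomologicalComplex (ModuleCat.{u} R) (ComplexShape.up' (a 0)) :=
      free (a 0) (fun j => Projective.over ((Y.page 0).X j))
    let ιF (j) : Projective.over ((Y.page 0).X j) ⟶ F.X j :=
      freeι (fun j => Projective.over ((Y.page 0).X j)) j
    -- The summand `F` is acyclic, so `i₀` is a quasi-isomorphism, and it is free on projectives
    -- covering `Y_0`, so it maps onto `Y_0` and lifts against any surjection.
    let i₀ : X.page 0 ⟶ X.page 0 ⊞ F := biprod.inl
    let p₁ : F ⟶ Y.page 0 := ofFree (fun j => Projective.π _)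
    let p₀ : X.page 0 ⊞ F ⟶ Y.page 0 := biprod.desc (f.hom 0) p₁
    obtain ⟨φ, i, p, hi, hi', hp, fac', H⟩ :=
      exists_factorization_of_head f _ i₀ p₀ (biprod.inl_desc _ _)
    refine ⟨_, i, p, fac', ?_, ?_, ?_, ?_, fun q hq => H q ?_⟩
    · intro j
      rw [hi]
      have : Projective (F.X j) := inferInstanceAs (Projective ((free (a 0) _).X j))
      exact ⟨F.X j, this, (biprodXIso (X.page 0) F j).symm, inl_biprodXIso_inv _ _ _⟩
    · rw [hi]
      exact inferInstanceAs (QuasiIso (biprod.inl : X.page 0 ⟶ X.page 0 ⊞ free (a 0) _))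
    · intro s hs
      obtain ⟨s, rfl⟩ := Nat.exists_eq_succ_of_ne_zero hs.ne'
      have : i.hom (s + 1) = 𝟙 (X.page (s + 1)) := congr_arg (fun g => g.hom s) hi'
      rw [this]
      exact inferInstanceAs (IsIso (𝟙 (X.page (s + 1))))
    · intro s hs
      obtain rfl := Nat.le_zero.1 hs
      rw [hp]
      intro j
      rw [← ModuleCat.epi_iff_surjective]
      have : Epi ((ιF j ≫ (biprod.inr : F ⟶ X.page 0 ⊞ F).f j) ≫ p₀.f j) := by
        rw [Category.assoc, ← comp_f, biprod.inr_desc, ι_ofFree]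
        infer_instance
      exact epi_of_epi (ιF j ≫ (biprod.inr : F ⟶ X.page 0 ⊞ F).f j) (p₀.f j)
    · refine ⟨fun {u w} sq => ?_⟩
      have (j : ℤ × ℤ) : Epi ((q.hom 0).f j) :=
        (ModuleCat.epi_iff_surjective _).2 (hq 0 le_rfl j)
      let w₁ : F ⟶ _ := biprod.inr ≫ w
      refine ⟨⟨biprod.desc u (ofFree (fun j =>
        Projective.factorThru (ιF j ≫ w₁.f j) ((q.hom 0).f j))),
        biprod.inl_desc _ _, ?_⟩⟩
      apply biprod.hom_ext'
      · rw [biprod.inl_desc_assoc, sq.w]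
      · rw [biprod.inr_desc_assoc]
        apply ofFree_ext
        intro j
        rw [comp_f, reassoc_of% @ι_ofFree, Projective.factorThru_comp]
  | succ r hr =>
    obtain ⟨T, i', p', fac, hi', hi'', hi''', hp', H⟩ := hr (tailMap f)
    obtain ⟨P, φ, i, p, hi, hp, fac', h₁, h₂, h₃⟩ := exists_cons_factorization f T i' p' fac hi'
    refine ⟨_, i, p, fac', h₂, ?_, ?_, surjective_succ h₁ ?_, fun q hq =>
      h₃ q (hq 0 (Nat.zero_le _)) (H _ hq.tail)⟩
    · rw [← hi] at hi''
      exact hi''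
    · intro s hs
      obtain ⟨s, rfl⟩ := Nat.exists_eq_succ_of_ne_zero (Nat.ne_zero_of_lt hs)
      have := hi''' s (Nat.lt_of_succ_lt_succ hs)
      rw [← hi] at this
      exact this
    · rwa [hp]

end PageTower

/-! ### Transfer of factorizations to extended spectral sequences. -/

namespace ExtendedSpectralSequence

variable {R : Type u} [CommRing R]

@[ext]
lemma hom_ext {X Y : ExtendedSpectralSequence R} {f g : X ⟶ Y} (h : ∀ s, f.hom s = g.hom s) :
    f = g :=
  Hom.ext (funext h)

/-- Extended spectral sequences, as towers of pages. -/
def toPageTower (X : ExtendedSpectralSequence R) :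
    PageTower R (fun s => (-(s : ℤ), 1 - (s : ℤ))) where
  page := X.page
  char := X.char

/-- Morphisms of extended spectral sequences, as morphisms of towers of pages. -/
def toPageTowerMap {X Y : ExtendedSpectralSequence R} (f : X ⟶ Y) :
    X.toPageTower ⟶ Y.toPageTower where
  hom := f.hom
  comm := f.comm

/-- Towers of pages, as extended spectral sequences. -/
def ofPageTower (X : PageTower R (fun s => (-(s : ℤ), 1 - (s : ℤ)))) :
    ExtendedSpectralSequence R where
  page := X.page
  char := X.char

/-- Morphisms of towers of pages, as morphisms of extended spectral sequences. -/
def ofPageTowerMap {X Y : PageTower R (fun s => (-(s : ℤ), 1 - (s : ℤ)))} (f : X ⟶ Y) :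
    ofPageTower X ⟶ ofPageTower Y where
  hom := f.hom
  comm := f.comm

lemma hasLiftingProperty_of_pageTower {X Y A B : ExtendedSpectralSequence R} (i : X ⟶ Y)
    (q : A ⟶ B) (h : HasLiftingProperty (toPageTowerMap i) (toPageTowerMap q)) :
    HasLiftingProperty i q where
  sq_hasLift {u w} sq := by
    have sq' : CommSq (toPageTowerMap u) (toPageTowerMap i) (toPageTowerMap q)
        (toPageTowerMap w) := ⟨congr_arg toPageTowerMap sq.w⟩
    exact ⟨⟨ofPageTowerMap sq'.lift, congr_arg ofPageTowerMap sq'.fac_left,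
      congr_arg ofPageTowerMap sq'.fac_right⟩⟩

lemma bidegree_ne_zero (s : ℕ) : (-(s : ℤ), 1 - (s : ℤ)) ≠ 0 := by
  intro h
  have h₁ := congr_arg Prod.fst h
  have h₂ := congr_arg Prod.snd h
  dsimp at h₁ h₂
  omega

lemma exists_factorization_fib_inf_weq (r : ℕ) {X Y : ExtendedSpectralSequence R} (f : X ⟶ Y) :
    ∃ (Z : ExtendedSpectralSequence R) (i : X ⟶ Z) (p : Z ⟶ Y), i ≫ p = f ∧
      (fib R r ⊓ weq R r).llp i ∧ (fib R r ⊓ weq R r) p := by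
  obtain ⟨Z, i, p, fac, -, hp, hp', H⟩ :=
    PageTower.exists_factorization_surjectiveQuasiIso r bidegree_ne_zero (toPageTowerMap f)
  exact ⟨ofPageTower Z, ofPageTowerMap i, ofPageTowerMap p, congr_arg ofPageTowerMap fac,
    fun _ _ q hq => hasLiftingProperty_of_pageTower _ _ (H (toPageTowerMap q) hq.1 hq.2),
    hp, hp'⟩

/-- The left factor lies in the smaller class `weq'`, so the same factorization serves both model
structures. -/
lemma exists_factorization_fib (r : ℕ) {X Y : ExtendedSpectralSequence R} (f : X ⟶ Y) :
    ∃ (Z : ExtendedSpectralSequence R) (i : X ⟶ Z) (p : Z ⟶ Y), i ≫ p = f ∧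
      (fib R r).llp i ∧ weq' R r i ∧ fib R r p := by
  obtain ⟨Z, i, p, fac, -, hi, hi', hp, H⟩ :=
    PageTower.exists_factorization_surjective r (toPageTowerMap f)
  exact ⟨ofPageTower Z, ofPageTowerMap i, ofPageTowerMap p, congr_arg ofPageTowerMap fac,
    fun _ _ q hq => hasLiftingProperty_of_pageTower _ _ (H (toPageTowerMap q) hq),
    ⟨hi, hi'⟩, hp⟩

end ExtendedSpectralSequence

/-! ### Construction of the pages of limits and colimits. -/

namespace HomologicalComplex

variable {R : Type u} [CommRing R] {a b : ℤ × ℤ} {J : Type u} [Category.{u} J]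
  (G : J ⥤ HomologicalComplex (ModuleCat.{u} R) (ComplexShape.up' a))
  (G' : J ⥤ HomologicalComplex (ModuleCat.{u} R) (ComplexShape.up' b))

/-- The limit of the homologies of a diagram of complexes. -/
noncomputable def limitHomology (pn : ℤ × ℤ) : ModuleCat.{u} R :=
  limit (G ⋙ homologyFunctor _ _ pn)

/-- The projections of the limit of the homologies of a diagram of complexes. -/
noncomputable def limitHomologyπ (pn : ℤ × ℤ) (j : J) :
    limitHomology G pn ⟶ (G.obj j).homology pn :=
  limit.π (G ⋙ homologyFunctor _ _ pn) j

section

variable {G} {pn : ℤ × ℤ} {A : ModuleCat.{u} R}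

lemma limitHomology_hom_ext {f g : A ⟶ limitHomology G pn}
    (h : ∀ j, f ≫ limitHomologyπ G pn j = g ≫ limitHomologyπ G pn j) : f = g :=
  limit.hom_ext h

variable (f : ∀ j, A ⟶ (G.obj j).homology pn)
  (hf : ∀ (j j' : J) (g : j ⟶ j'), f j ≫ homologyMap (G.map g) pn = f j')

/-- Constructor for morphisms to the limit of the homologies of a diagram of complexes. -/
noncomputable def limitHomologyLift : A ⟶ limitHomology G pn :=
  limit.lift (G ⋙ homologyFunctor _ _ pn)
    { pt := A
      π :=
        { app := f
          naturality _ _ g := (Category.id_comp _).trans (hf _ _ g).symm } }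

@[simp]
lemma limitHomologyLift_π (j : J) : limitHomologyLift f hf ≫ limitHomologyπ G pn j = f j :=
  limit.lift_π _ _

end

variable {G G'} (χ : ∀ pn j, (G'.obj j).X pn ⟶ (G.obj j).homology pn)
  (hχ : ∀ (pn) (j j' : J) (g : j ⟶ j'),
    χ pn j ≫ homologyMap (G.map g) pn = (G'.map g).f pn ≫ χ pn j')
  {P : HomologicalComplex (ModuleCat.{u} R) (ComplexShape.up' a)} (π : ∀ j, P ⟶ G.obj j)
  (hπ : ∀ (j j' : J) (g : j ⟶ j'), π j ≫ G.map g = π j')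

/-- The map induced on limits by a compatible family of maps to homologies. -/
noncomputable def limitChar (pn : ℤ × ℤ) : (limit G').X pn ⟶ limitHomology G pn :=
  limitHomologyLift (fun j => (limit.π G' j).f pn ≫ χ pn j) (fun _ _ g => by
    rw [Category.assoc, hχ, ← limit.w G' g, comp_f, Category.assoc])

lemma limitChar_π (pn : ℤ × ℤ) (j : J) :
    limitChar χ hχ pn ≫ limitHomologyπ G pn j = (limit.π G' j).f pn ≫ χ pn j :=
  limitHomologyLift_π _ _ j

/-- The comparison from the homology of the point of a cone to the limit of the homologies. -/
noncomputable def homologyToLimit (pn : ℤ × ℤ) : P.homology pn ⟶ limitHomology G pn :=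
  limitHomologyLift (fun j => homologyMap (π j) pn) (fun _ _ g => by
    rw [← hπ _ _ g, homologyMap_comp])

lemma homologyToLimit_π (pn : ℤ × ℤ) (j : J) :
    homologyToLimit π hπ pn ≫ limitHomologyπ G pn j = homologyMap (π j) pn :=
  limitHomologyLift_π _ _ j

/-- The universal complex with a map to the limit of `G'` which lifts to the homology of `P`. -/
noncomputable def limitPage : HomologicalComplex (ModuleCat.{u} R) (ComplexShape.up' b) :=
  pullback (toCofree (limitChar χ hχ)) (cofreeMap (homologyToLimit π hπ))

/-- The map from `limitPage` to the limit. -/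
noncomputable def limitPageFst : limitPage χ hχ π hπ ⟶ limit G' :=
  pullback.fst _ _

/-- The map from `limitPage` to the cofree complex on the homology. -/
noncomputable def limitPageSnd :
    limitPage χ hχ π hπ ⟶ cofree b (fun pn => P.homology pn) :=
  pullback.snd (toCofree (limitChar χ hχ)) (cofreeMap (homologyToLimit π hπ))

lemma limitPage_condition :
    limitPageFst χ hχ π hπ ≫ toCofree (limitChar χ hχ) =
      limitPageSnd χ hχ π hπ ≫ cofreeMap (homologyToLimit π hπ) :=
  pullback.condition

/-- The map from `limitPage` to the homology. -/
noncomputable def limitPageChar (pn : ℤ × ℤ) : (limitPage χ hχ π hπ).X pn ⟶ P.homology pn :=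
  (limitPageSnd χ hχ π hπ).f pn ≫ cofreeπ _ pn

/-- The projections of `limitPage`. -/
noncomputable def limitPageπ (j : J) : limitPage χ hχ π hπ ⟶ G'.obj j :=
  limitPageFst χ hχ π hπ ≫ limit.π G' j

lemma limitPageπ_naturality (j j' : J) (g : j ⟶ j') :
    limitPageπ χ hχ π hπ j ≫ G'.map g = limitPageπ χ hχ π hπ j' := by
  rw [limitPageπ, limitPageπ, Category.assoc, limit.w]

lemma limitPageChar_homologyMap (pn : ℤ × ℤ) (j : J) :
    limitPageChar χ hχ π hπ pn ≫ homologyMap (π j) pn =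
      (limitPageπ χ hχ π hπ j).f pn ≫ χ pn j := by
  have h := congr_hom (limitPage_condition χ hχ π hπ) pn =≫ cofreeπ _ pn
  rw [comp_f, comp_f, Category.assoc, Category.assoc, toCofree_π, cofreeMap_π] at h
  have h' := h =≫ limitHomologyπ G pn j
  rw [Category.assoc, Category.assoc, Category.assoc, limitChar_π, homologyToLimit_π] at h'
  rw [limitPageπ, comp_f, Category.assoc, h', limitPageChar, Category.assoc]

/-- Graded maps `ψ` to the homology of `P` are the same as chain maps to the cofree complex on it,
so the data `t` and `ψ` form a cone over the defining pullback. -/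
lemma exists_limitPage_lift {T : HomologicalComplex (ModuleCat.{u} R) (ComplexShape.up' b)}
    (t : ∀ j, T ⟶ G'.obj j) (ht : ∀ (j j' : J) (g : j ⟶ j'), t j ≫ G'.map g = t j')
    (ψ : ∀ pn, T.X pn ⟶ P.homology pn)
    (hψ : ∀ pn j, ψ pn ≫ homologyMap (π j) pn = (t j).f pn ≫ χ pn j) :
    ∃ m : T ⟶ limitPage χ hχ π hπ, (∀ j, m ≫ limitPageπ χ hχ π hπ j = t j) ∧
      ∀ pn, m.f pn ≫ limitPageChar χ hχ π hπ pn = ψ pn := by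
  let c : Cone G' :=
    { pt := T
      π :=
        { app := t
          naturality _ _ g := (Category.id_comp _).trans (ht _ _ g).symm } }
  let l : T ⟶ limit G' := limit.lift G' c
  have hl (j) : l ≫ limit.π G' j = t j := limit.lift_π c j
  have H : l ≫ toCofree (limitChar χ hχ) = toCofree ψ ≫ cofreeMap (homologyToLimit π hπ) := by
    apply toCofree_ext
    intro pn
    rw [comp_f, comp_f, Category.assoc, Category.assoc, toCofree_π, cofreeMap_π,
      reassoc_of% @toCofree_π]
    apply limitHomology_hom_ext
    intro j
    rw [Category.assoc, Category.assoc, limitChar_π, homologyToLimit_π, hψ, ← hl, comp_f,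
      Category.assoc]
  let m : T ⟶ limitPage χ hχ π hπ := pullback.lift l (toCofree ψ) H
  have hm₁ : m ≫ limitPageFst χ hχ π hπ = l := pullback.lift_fst _ _ H
  have hm₂ : m ≫ limitPageSnd χ hχ π hπ = toCofree ψ := pullback.lift_snd _ _ H
  refine ⟨m, fun j => ?_, fun pn => ?_⟩
  · rw [limitPageπ, ← Category.assoc, hm₁, hl]
  · rw [limitPageChar, ← Category.assoc, ← comp_f, hm₂, toCofree_π]

lemma limitPage_hom_ext {T : HomologicalComplex (ModuleCat.{u} R) (ComplexShape.up' b)}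
    {m m' : T ⟶ limitPage χ hχ π hπ}
    (h : ∀ j, m ≫ limitPageπ χ hχ π hπ j = m' ≫ limitPageπ χ hχ π hπ j)
    (h' : ∀ pn, m.f pn ≫ limitPageChar χ hχ π hπ pn = m'.f pn ≫ limitPageChar χ hχ π hπ pn) :
    m = m' := by
  have h₁ : m ≫ limitPageFst χ hχ π hπ = m' ≫ limitPageFst χ hχ π hπ := by
    apply limit.hom_ext
    intro j
    rw [Category.assoc, Category.assoc]
    exact h j
  have h₂ : m ≫ limitPageSnd χ hχ π hπ = m' ≫ limitPageSnd χ hχ π hπ := by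
    apply toCofree_ext
    intro pn
    rw [comp_f, comp_f, Category.assoc, Category.assoc]
    exact h' pn
  exact pullback.hom_ext h₁ h₂

/-- The map induced on colimits by a compatible family of maps to homologies. -/
noncomputable def colimitChar (pn : ℤ × ℤ) : (colimit G').X pn ⟶ (colimit G).homology pn :=
  (isColimitOfPreserves (eval _ _ pn) (colimit.isColimit G')).desc
    { pt := (colimit G).homology pn
      ι :=
        { app j := χ pn j ≫ homologyMap (colimit.ι G j) pn
          naturality j j' g := by
            change (G'.map g).f pn ≫ χ pn j' ≫ homologyMap (colimit.ι G j') pn =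
              (χ pn j ≫ homologyMap (colimit.ι G j) pn) ≫ 𝟙 _
            rw [← colimit.w G g, homologyMap_comp, Category.comp_id, ← Category.assoc, ← hχ,
              Category.assoc] } }

lemma ι_colimitChar (pn : ℤ × ℤ) (j : J) :
    (colimit.ι G' j).f pn ≫ colimitChar χ hχ pn = χ pn j ≫ homologyMap (colimit.ι G j) pn :=
  (isColimitOfPreserves (eval _ _ pn) (colimit.isColimit G')).fac _ j

lemma colimit_X_hom_ext {pn : ℤ × ℤ} {A : ModuleCat.{u} R} {f g : (colimit G').X pn ⟶ A}
    (h : ∀ j, (colimit.ι G' j).f pn ≫ f = (colimit.ι G' j).f pn ≫ g) : f = g :=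
  (isColimitOfPreserves (eval _ _ pn) (colimit.isColimit G')).hom_ext h

end HomologicalComplex

/-! ### Limits and colimits of extended spectral sequences. -/

namespace ExtendedSpectralSequence

open HomologicalComplex

variable {R : Type u} [CommRing R]

variable (R) in
/-- The functor sending an extended spectral sequence to its `s`-th page. -/
def pageFunctor (s : ℕ) : ExtendedSpectralSequence R ⥤ BigradedComplex R s where
  obj X := X.page s
  map f := f.hom s

section

variable {J : Type u} [Category.{u} J] (F : J ⥤ ExtendedSpectralSequence R)

/-- The diagram of the `s`-th pages. -/
def pageDiagram (s : ℕ) : J ⥤ BigradedComplex R s := F ⋙ pageFunctor R s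

/-- The characteristic maps of a diagram of extended spectral sequences. -/
def diagramChar (s : ℕ) (pn : ℤ × ℤ) (j : J) :
    ((pageDiagram F (s + 1)).obj j).X pn ⟶ ((pageDiagram F s).obj j).homology pn :=
  (F.obj j).char s pn

lemma diagramChar_naturality (s : ℕ) (pn : ℤ × ℤ) (j j' : J) (g : j ⟶ j') :
    diagramChar F s pn j ≫ homologyMap ((pageDiagram F s).map g) pn =
      ((pageDiagram F (s + 1)).map g).f pn ≫ diagramChar F s pn j' :=
  (F.map g).comm s pn

/-- The colimit of a functor to extended spectral sequences. -/
noncomputable def colimitObj : ExtendedSpectralSequence R where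
  page s := colimit (pageDiagram F s)
  char s pn := colimitChar (diagramChar F s) (diagramChar_naturality F s) pn

/-- The colimit cocone of a functor to extended spectral sequences. -/
noncomputable def colimitCocone : Cocone F where
  pt := colimitObj F
  ι :=
    { app j :=
        { hom s := colimit.ι (pageDiagram F s) j
          comm s pn := (ι_colimitChar (diagramChar F s) (diagramChar_naturality F s) pn j).symm }
      naturality j j' g := by
        ext1 s
        exact (colimit.w (pageDiagram F s) g).trans (Category.comp_id _).symm }

/-- The colimit cocone of extended spectral sequences is colimit. -/
noncomputable def isColimitColimitCocone : IsColimit (colimitCocone F) where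
  desc t :=
    { hom s := colimit.desc (pageDiagram F s) ((pageFunctor R s).mapCocone t)
      comm s pn := by
        let d (s) : colimit (pageDiagram F s) ⟶ t.pt.page s :=
          colimit.desc (pageDiagram F s) ((pageFunctor R s).mapCocone t)
        let ι (s j) : (pageDiagram F s).obj j ⟶ t.pt.page s := (t.ι.app j).hom s
        have hd (s j) : colimit.ι (pageDiagram F s) j ≫ d s = ι s j := colimit.ι_desc _ _
        have h (j) : diagramChar F s pn j ≫ homologyMap (ι s j) pn =
          (ι (s + 1) j).f pn ≫ t.pt.char s pn := (t.ι.app j).comm s pn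
        change colimitChar (diagramChar F s) (diagramChar_naturality F s) pn ≫
          homologyMap (d s) pn = (d (s + 1)).f pn ≫ t.pt.char s pn
        apply colimit_X_hom_ext
        intro j
        rw [reassoc_of% @ι_colimitChar, ← homologyMap_comp, hd, h, ← hd, comp_f, Category.assoc] }
  fac t j := by
    ext1 s
    exact colimit.ι_desc ((pageFunctor R s).mapCocone t) j
  uniq t m hm := by
    ext1 s
    refine colimit.hom_ext (F := pageDiagram F s) fun j => ?_
    refine Eq.trans ?_ (colimit.ι_desc (F := pageDiagram F s)
      ((pageFunctor R s).mapCocone t) j).symm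
    exact congr_arg (fun g => Hom.hom g s) (hm j)

/-- The cones which define the pages of a limit of extended spectral sequences. -/
noncomputable def limitPageCone : ∀ s : ℕ,
    Σ P : BigradedComplex R s, { π : ∀ j, P ⟶ (pageDiagram F s).obj j //
      ∀ (j j' : J) (g : j ⟶ j'), π j ≫ (pageDiagram F s).map g = π j' }
  | 0 => ⟨limit (pageDiagram F 0), limit.π _, fun _ _ => limit.w _⟩
  | s + 1 =>
    ⟨limitPage (diagramChar F s) (diagramChar_naturality F s) (limitPageCone s).2.1
      (limitPageCone s).2.2, limitPageπ _ _ _ _, limitPageπ_naturality _ _ _ _⟩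

/-- The limit of a functor to extended spectral sequences. -/
noncomputable def limitObj : ExtendedSpectralSequence R where
  page s := (limitPageCone F s).1
  char s pn := limitPageChar (diagramChar F s) (diagramChar_naturality F s) (limitPageCone F s).2.1
    (limitPageCone F s).2.2 pn

/-- The limit cone of a functor to extended spectral sequences. -/
noncomputable def limitCone : Cone F where
  pt := limitObj F
  π :=
    { app j :=
        { hom s := (limitPageCone F s).2.1 j
          comm s pn := limitPageChar_homologyMap _ _ _ _ pn j }
      naturality j j' g := by
        ext1 s
        exact (Category.id_comp _).trans ((limitPageCone F s).2.2 j j' g).symm }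

lemma exists_limitObj_lift (t : Cone F) (s : ℕ)
    (m : t.pt.page s ⟶ (limitPageCone F s).1)
    (hm : ∀ j, m ≫ (limitPageCone F s).2.1 j = (t.π.app j).hom s) :
    ∃ m' : t.pt.page (s + 1) ⟶ (limitPageCone F (s + 1)).1,
      (∀ j, m' ≫ (limitPageCone F (s + 1)).2.1 j = (t.π.app j).hom (s + 1)) ∧
      ∀ pn, m'.f pn ≫ (limitObj F).char s pn = t.pt.char s pn ≫ homologyMap m pn := by
  let τ (s j) : t.pt.page s ⟶ (pageDiagram F s).obj j := (t.π.app j).hom s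
  have hτ (pn j) : t.pt.char s pn ≫ homologyMap (τ s j) pn =
    (τ (s + 1) j).f pn ≫ diagramChar F s pn j := (t.π.app j).comm s pn
  have hm' (j) : m ≫ (limitPageCone F s).2.1 j = τ s j := hm j
  exact exists_limitPage_lift (diagramChar F s) (diagramChar_naturality F s)
    (limitPageCone F s).2.1 (limitPageCone F s).2.2 (τ (s + 1))
    (fun _ _ g => congr_arg (fun f => Hom.hom f (s + 1)) (t.w g))
    (fun pn => t.pt.char s pn ≫ homologyMap m pn) (fun pn j => by
      rw [Category.assoc, ← homologyMap_comp, hm', hτ])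

/-- The components of the morphism to a limit of extended spectral sequences. -/
noncomputable def limitLift (t : Cone F) : ∀ s : ℕ,
    { m : t.pt.page s ⟶ (limitObj F).page s //
      ∀ j, m ≫ (limitPageCone F s).2.1 j = (t.π.app j).hom s }
  | 0 => ⟨limit.lift (pageDiagram F 0) ((pageFunctor R 0).mapCone t),
      fun j => limit.lift_π (F := pageDiagram F 0) ((pageFunctor R 0).mapCone t) j⟩
  | s + 1 =>
    ⟨(exists_limitObj_lift F t s (limitLift t s).1 (limitLift t s).2).choose,
      (exists_limitObj_lift F t s (limitLift t s).1 (limitLift t s).2).choose_spec.1⟩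

lemma limitLift_succ_char (t : Cone F) (s : ℕ) (pn : ℤ × ℤ) :
    (limitLift F t (s + 1)).1.f pn ≫ (limitObj F).char s pn =
      t.pt.char s pn ≫ homologyMap (limitLift F t s).1 pn :=
  (exists_limitObj_lift F t s (limitLift F t s).1 (limitLift F t s).2).choose_spec.2 pn

/-- The limit cone of extended spectral sequences is limit. -/
noncomputable def isLimitLimitCone : IsLimit (limitCone F) where
  lift t :=
    { hom s := (limitLift F t s).1
      comm s pn := (limitLift_succ_char F t s pn).symm }
  fac t j := by
    ext1 s
    exact (limitLift F t s).2 j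
  uniq t m hm := by
    let n (s) : t.pt.page s ⟶ (limitObj F).page s := m.hom s
    have hm' (s j) : n s ≫ (limitPageCone F s).2.1 j = (t.π.app j).hom s :=
      congr_arg (fun g => Hom.hom g s) (hm j)
    ext1 s
    change n s = (limitLift F t s).1
    induction s with
    | zero =>
      refine limit.hom_ext (F := pageDiagram F 0) fun j => ?_
      exact (hm' 0 j).trans ((limitLift F t 0).2 j).symm
    | succ s hs =>
      refine limitPage_hom_ext _ _ _ _ (fun j => ?_) (fun pn => ?_)
      · exact (hm' (s + 1) j).trans ((limitLift F t (s + 1)).2 j).symm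
      · have h : t.pt.char s pn ≫ homologyMap (n s) pn =
          (n (s + 1)).f pn ≫ (limitObj F).char s pn := m.comm s pn
        -- Uniqueness on page `s` enters here: the characteristic component of the map on page `s +
        -- 1` is determined by the homology of the map on page `s`.
        rw [hs] at h
        exact h.symm.trans (limitLift_succ_char F t s pn).symm

end

instance : HasColimits (ExtendedSpectralSequence R) where
  has_colimits_of_shape _ _ := ⟨fun F => ⟨⟨⟨_, isColimitColimitCocone F⟩⟩⟩⟩

instance : HasLimits (ExtendedSpectralSequence R) where
  has_limits_of_shape _ _ := ⟨fun F => ⟨⟨⟨_, isLimitLimitCone F⟩⟩⟩⟩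

end ExtendedSpectralSequence

/-! ### The factorization adapted to `weq'`. -/

namespace PageTower

open HomologicalComplex

variable {R : Type u} [CommRing R] {a : ℕ → ℤ × ℤ}

lemma isIso_of_isIso_hom {X Y : PageTower R a} (f : X ⟶ Y) [∀ s, IsIso (f.hom s)] : IsIso f := by
  let g : Y ⟶ X :=
    { hom s := inv (f.hom s)
      comm s pn := by
        have h : (inv (f.hom (s + 1))).f pn ≫ (f.hom (s + 1)).f pn = 𝟙 _ := by
          rw [← comp_f, IsIso.inv_hom_id, id_f]
        have h' : homologyMap (f.hom s) pn ≫ homologyMap (inv (f.hom s)) pn = 𝟙 _ := by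
          rw [← homologyMap_comp, IsIso.hom_inv_id, homologyMap_id]
        have h'' := f.comm s pn
        rw [← Category.id_comp (Y.char s pn), ← h, Category.assoc, Category.assoc,
          ← reassoc_of% h'', h', Category.comp_id] }
  exact ⟨g, by ext1 s; exact IsIso.hom_inv_id (f.hom s),
    by ext1 s; exact IsIso.inv_hom_id (f.hom s)⟩

/-- A factorization of a morphism on the first page whose second morphism is a quasi-isomorphism
gives a factorization of the morphism, whose second component is an isomorphism on the
other pages. -/
lemma exists_factorization_of_quasiIso {X Y : PageTower R a} (f : X ⟶ Y)
    (W : HomologicalComplex (ModuleCat.{u} R) (ComplexShape.up' (a 0)))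
    (i₀ : X.page 0 ⟶ W) (p₀ : W ⟶ Y.page 0) (fac : i₀ ≫ p₀ = f.hom 0) [QuasiIso p₀] :
    ∃ (φ : ∀ pn, (Y.tail.page 0).X pn ⟶ W.homology pn) (i : X ⟶ cons W Y.tail φ)
      (p : cons W Y.tail φ ⟶ Y),
      i.hom 0 = i₀ ∧ p.hom 0 = p₀ ∧ tailMap p = 𝟙 _ ∧ i ≫ p = f ∧
      ∀ {A B : PageTower R a} (q : A ⟶ B), QuasiIso (q.hom 0) → IsIso (tailMap q) →
        HasLiftingProperty i₀ (q.hom 0) → HasLiftingProperty i q := by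
  -- The later pages are now those of `Y`, making `p` the identity there; their characteristic map
  -- reaches `W` by inverting `p₀` in homology.
  let φ (pn) : (Y.tail.page 0).X pn ⟶ W.homology pn := Y.headChar pn ≫ inv (homologyMap p₀ pn)
  have hφ (pn) : φ pn ≫ homologyMap p₀ pn = Y.headChar pn := by simp [φ]
  let f' : X.tail ⟶ Y.tail := tailMap f
  have hi (pn) : X.headChar pn ≫ homologyMap i₀ pn = (f'.hom 0).f pn ≫ φ pn := by
    rw [← cancel_mono (homologyMap p₀ pn), Category.assoc, Category.assoc, hφ,
      ← homologyMap_comp, fac]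
    exact headChar_comm f pn
  let i : X ⟶ cons W Y.tail φ := consHom i₀ f' hi
  let p : cons W Y.tail φ ⟶ Y := consHom p₀ (𝟙 Y.tail)
    (fun pn => (hφ pn).trans (Category.id_comp _).symm)
  refine ⟨φ, i, p, rfl, rfl, rfl, ?_, ?_⟩
  · ext1 s
    cases s with
    | zero => exact fac
    | succ s => exact Category.comp_id (f.hom (s + 1))
  · intro A B q _ _ hq
    refine ⟨fun {u w} sq => ?_⟩
    let w₀ : W ⟶ B.page 0 := w.hom 0
    let w' : Y.tail ⟶ B.tail := tailMap (X := cons W Y.tail φ) w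
    have hw (pn) : φ pn ≫ homologyMap w₀ pn = (w'.hom 0).f pn ≫ B.headChar pn :=
      headChar_comm (X := cons W Y.tail φ) w pn
    have sq₀ : CommSq (u.hom 0) i₀ (q.hom 0) w₀ := ⟨congr_arg (fun g => g.hom 0) sq.w⟩
    have sq' : tailMap u ≫ tailMap q = f' ≫ w' := congr_arg (tailMap (X := X) (Y := B)) sq.w
    let ℓ' : Y.tail ⟶ A.tail := w' ≫ inv (tailMap q)
    have hℓ : ℓ' ≫ tailMap q = w' := by simp [ℓ']
    have hℓ' : f' ≫ ℓ' = tailMap u := by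
      rw [← cancel_mono (tailMap q), Category.assoc, hℓ, sq']
    have hℓ₀ (pn) : φ pn ≫ homologyMap sq₀.lift pn = (ℓ'.hom 0).f pn ≫ A.headChar pn := by
      rw [← cancel_mono (homologyMap (q.hom 0) pn), Category.assoc,
        ← homologyMap_comp, sq₀.fac_right, hw, Category.assoc, headChar_comm, ← hℓ, comp_hom,
        comp_f, Category.assoc]
    let ℓ : cons W Y.tail φ ⟶ A := consHom sq₀.lift ℓ' hℓ₀
    refine ⟨⟨ℓ, ?_, ?_⟩⟩
    · ext1 s
      cases s with
      | zero => exact sq₀.fac_left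
      | succ s => exact congr_arg (fun g => g.hom s) hℓ'
    · ext1 s
      cases s with
      | zero => exact sq₀.fac_right
      | succ s => exact congr_arg (fun g => g.hom s) hℓ

/-- Only the base case differs from `exists_factorization_surjectiveQuasiIso`: pages beyond `r` are
taken from `Y`, and lifts there come from inverting `q`. -/
lemma exists_factorization_isIso (r : ℕ) {a : ℕ → ℤ × ℤ} (ha : ∀ s, a s ≠ 0)
    {X Y : PageTower R a} (f : X ⟶ Y) :
    ∃ (Z : PageTower R a) (i : X ⟶ Z) (p : Z ⟶ Y), i ≫ p = f ∧
      (∀ j, ModuleCat.IsSplitWithProjectiveComplement ((i.hom 0).f j)) ∧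
      Surjective r p ∧ QuasiIso (p.hom r) ∧ (∀ s, r < s → IsIso (p.hom s)) ∧
      ∀ {A B : PageTower R a} (q : A ⟶ B), Surjective r q → QuasiIso (q.hom r) →
        (∀ s, r < s → IsIso (q.hom s)) → HasLiftingProperty i q := by
  induction r generalizing a with
  | zero =>
    obtain ⟨W, i₀, p₀, fac, hi₀, hp₀⟩ :=
      HomologicalComplex.exists_factorization_surjectiveQuasiIso (ha 0) (f.hom 0)
    have := hp₀.2
    obtain ⟨φ, i, p, hi, hp, hp', fac', H⟩ := exists_factorization_of_quasiIso f W i₀ p₀ fac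
    refine ⟨_, i, p, fac', ?_, ?_, ?_, ?_, fun q hq hq' hq'' =>
      H q hq' ?_ (hi₀ _ ⟨hq 0 le_rfl, hq'⟩)⟩
    · rw [hi]
      exact isSplitWithProjectiveComplement_of_llp i₀ hi₀
    · intro s hs
      obtain rfl := Nat.le_zero.1 hs
      rw [hp]
      exact hp₀.1
    · rw [hp]
      exact hp₀.2
    · intro s hs
      obtain ⟨s, rfl⟩ := Nat.exists_eq_succ_of_ne_zero hs.ne'
      have : p.hom (s + 1) = 𝟙 (Y.page (s + 1)) := congr_arg (fun g => g.hom s) hp'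
      rw [this]
      exact inferInstanceAs (IsIso (𝟙 (Y.page (s + 1))))
    · have (s : ℕ) : IsIso ((tailMap q).hom s) := hq'' (s + 1) (Nat.succ_pos s)
      exact isIso_of_isIso_hom _
  | succ r hr =>
    obtain ⟨T, i', p', fac, hi', hp', hp'', hp''', H⟩ := hr (fun s => ha (s + 1)) (tailMap f)
    obtain ⟨P, φ, i, p, hi, hp, fac', h₁, h₂, h₃⟩ := exists_cons_factorization f T i' p' fac hi'
    refine ⟨_, i, p, fac', h₂, surjective_succ h₁ ?_, ?_, ?_, fun q hq hq' hq'' =>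
      h₃ q (hq 0 (Nat.zero_le _)) (H _ hq.tail hq' (fun s hs => hq'' _ (Nat.succ_lt_succ hs)))⟩
    · rwa [hp]
    · rw [← hp] at hp''
      exact hp''
    · intro s hs
      obtain ⟨s, rfl⟩ := Nat.exists_eq_succ_of_ne_zero (Nat.ne_zero_of_lt hs)
      have := hp''' s (Nat.lt_of_succ_lt_succ hs)
      rw [← hp] at this
      exact this

end PageTower

namespace ExtendedSpectralSequence

variable {R : Type u} [CommRing R]

lemma exists_factorization_fib_inf_weq' (r : ℕ) {X Y : ExtendedSpectralSequence R} (f : X ⟶ Y) :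
    ∃ (Z : ExtendedSpectralSequence R) (i : X ⟶ Z) (p : Z ⟶ Y), i ≫ p = f ∧
      (fib R r ⊓ weq' R r).llp i ∧ (fib R r ⊓ weq' R r) p := by
  obtain ⟨Z, i, p, fac, -, hp, hp', hp'', H⟩ :=
    PageTower.exists_factorization_isIso r bidegree_ne_zero (toPageTowerMap f)
  exact ⟨ofPageTower Z, ofPageTowerMap i, ofPageTowerMap p, congr_arg ofPageTowerMap fac,
    fun _ _ q hq => hasLiftingProperty_of_pageTower _ _
      (H (toPageTowerMap q) hq.1 hq.2.1 hq.2.2),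
    hp, hp', hp''⟩

end ExtendedSpectralSequence

/-! ### Model structures from two factorizations. -/

namespace HomotopicalAlgebra.ModelCategory

variable {C : Type u₁} [Category.{v₁} C] (F W : MorphismProperty C)

/-- Two factorization properties on classes of fibrations and weak equivalences which give a
model structure. -/
structure HasFactorizations : Prop where
  exists_trivialFibration {X Y : C} (f : X ⟶ Y) : ∃ (Z : C) (i : X ⟶ Z) (p : Z ⟶ Y), i ≫ p = f ∧
    (F ⊓ W).llp i ∧ (F ⊓ W) p
  exists_fibration {X Y : C} (f : X ⟶ Y) : ∃ (Z : C) (i : X ⟶ Z) (p : Z ⟶ Y), i ≫ p = f ∧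
    F.llp i ∧ W i ∧ F p

variable {F W}

/-- Retract argument: lifting against its own factor `p` makes `f` a retract of `i`, which is in
`W`. -/
lemma HasFactorizations.llp_le (h : HasFactorizations F W) [W.IsStableUnderRetracts] :
    F.llp ≤ W := by
  intro X Y f hf
  obtain ⟨Z, i, p, fac, -, hi, hp⟩ := h.exists_fibration f
  have := hf p hp
  exact W.of_retract (RetractArrow.ofLeftLiftingProperty fac) hi

lemma HasFactorizations.llp_inf_eq (h : HasFactorizations F W) [W.IsStableUnderRetracts]
    [W.HasTwoOutOfThreeProperty] : (F ⊓ W).llp ⊓ W = F.llp := by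
  refine le_antisymm ?_ (le_inf (MorphismProperty.antitone_llp inf_le_left) h.llp_le)
  rintro X Y f ⟨hf, hf'⟩
  obtain ⟨Z, i, p, fac, hi, hi', hp⟩ := h.exists_fibration f
  -- By two out of three `p` is a trivial fibration, so `f` lifts against it and is a retract of
  -- `i`.
  have := hf p ⟨hp, W.of_precomp i p hi' (by rwa [fac])⟩
  exact F.llp.of_retract (RetractArrow.ofLeftLiftingProperty fac) hi

/-- The model structure with given fibrations and weak equivalences. -/
@[reducible]
def ofHasFactorizations (h : HasFactorizations F W) [HasFiniteLimits C] [HasFiniteColimits C]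
    [F.IsStableUnderRetracts] [W.IsStableUnderRetracts] [W.HasTwoOutOfThreeProperty] :
    ModelCategory C :=
  letI : CategoryWithFibrations C := ⟨F⟩
  letI : CategoryWithCofibrations C := ⟨(F ⊓ W).llp⟩
  letI : CategoryWithWeakEquivalences C := ⟨W⟩
  have e : trivialCofibrations C = F.llp := h.llp_inf_eq
  haveI : (weakEquivalences C).HasTwoOutOfThreeProperty :=
    inferInstanceAs W.HasTwoOutOfThreeProperty
  haveI : (F ⊓ W).IsStableUnderRetracts :=
    ⟨fun r hg => ⟨F.of_retract r hg.1, W.of_retract r hg.2⟩⟩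
  haveI : MorphismProperty.IsWeakFactorizationSystem (cofibrations C) (trivialFibrations C) := by
    change MorphismProperty.IsWeakFactorizationSystem (F ⊓ W).llp (F ⊓ W)
    have : MorphismProperty.HasFactorization (F ⊓ W).llp (F ⊓ W) := ⟨fun f => by
      obtain ⟨Z, i, p, fac, hi, hp⟩ := h.exists_trivialFibration f
      exact ⟨⟨Z, i, p, fac, hi, hp⟩⟩⟩
    exact .mk' _ _ (fun i p hi hp => hi p hp)
  haveI : MorphismProperty.IsWeakFactorizationSystem (trivialCofibrations C) (fibrations C) := by
    rw [e]
    change MorphismProperty.IsWeakFactorizationSystem F.llp F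
    have : MorphismProperty.HasFactorization F.llp F := ⟨fun f => by
      obtain ⟨Z, i, p, fac, hi, -, hp⟩ := h.exists_fibration f
      exact ⟨⟨Z, i, p, fac, hi, hp⟩⟩⟩
    exact .mk' _ _ (fun i p hi hp => hi p hp)
  mk' C

end HomotopicalAlgebra.ModelCategory

/-! ### Closure properties of the classes, and test objects. -/

namespace ExtendedSpectralSequence

variable (R : Type u) [CommRing R] (r : ℕ)

variable {R} in
/-- The retract of pages of a retract of extended spectral sequences. -/
def retractArrowHom {X Y X' Y' : ExtendedSpectralSequence R} {f : X ⟶ Y} {g : X' ⟶ Y'}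
    (h : RetractArrow f g) (s : ℕ) : RetractArrow (f.hom s) (g.hom s) :=
  h.map (pageFunctor R s)

instance : (fib R r).IsStableUnderRetracts where
  of_retract {_ _ _ _ f g} h hg s hs pn := by
    have := (ModuleCat.epi_iff_surjective _).2 (hg s hs pn)
    rw [← ModuleCat.epi_iff_surjective]
    exact (MorphismProperty.epimorphisms _).of_retract
      ((retractArrowHom h s).map (HomologicalComplex.eval _ _ pn)) this

instance : (weq R r).IsStableUnderRetracts where
  of_retract {_ _ _ _ _ g} h hg := by
    have : QuasiIso (g.hom r) := hg
    exact quasiIso_of_retractArrow (retractArrowHom h r)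

instance : (weq' R r).IsStableUnderRetracts where
  of_retract h hg :=
    ⟨(weq R r).of_retract h hg.1, fun s hs =>
      (MorphismProperty.isomorphisms _).of_retract (retractArrowHom h s) (hg.2 s hs)⟩

instance : (weq R r).HasTwoOutOfThreeProperty where
  comp_mem f g hf hg := by
    have : QuasiIso (f.hom r) := hf
    have : QuasiIso (g.hom r) := hg
    exact inferInstanceAs (QuasiIso (f.hom r ≫ g.hom r))
  of_postcomp f g hg hfg := by
    have : QuasiIso (g.hom r) := hg
    have : QuasiIso (f.hom r ≫ g.hom r) := hfg
    exact quasiIso_of_comp_right (f.hom r) (g.hom r)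
  of_precomp f g hf hfg := by
    have : QuasiIso (f.hom r) := hf
    have : QuasiIso (f.hom r ≫ g.hom r) := hfg
    exact quasiIso_of_comp_left (f.hom r) (g.hom r)

instance : (weq' R r).HasTwoOutOfThreeProperty where
  comp_mem f g hf hg :=
    ⟨(weq R r).comp_mem f g hf.1 hg.1, fun s hs =>
      (MorphismProperty.isomorphisms _).comp_mem (f.hom s) (g.hom s) (hf.2 s hs) (hg.2 s hs)⟩
  of_postcomp f g hg hfg :=
    ⟨(weq R r).of_postcomp (W' := weq R r) f g hg.1 hfg.1, fun s hs =>
      (MorphismProperty.isomorphisms _).of_postcomp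
        (W' := .isomorphisms _) (f.hom s) (g.hom s) (hg.2 s hs) (hfg.2 s hs)⟩
  of_precomp f g hf hfg :=
    ⟨(weq R r).of_precomp (W' := weq R r) f g hf.1 hfg.1, fun s hs =>
      (MorphismProperty.isomorphisms _).of_precomp
        (W' := .isomorphisms _) (f.hom s) (g.hom s) (hf.2 s hs) (hfg.2 s hs)⟩

lemma hasFactorizations_weq : ModelCategory.HasFactorizations (fib R r) (weq R r) where
  exists_trivialFibration f := exists_factorization_fib_inf_weq r f
  exists_fibration f := by
    obtain ⟨Z, i, p, fac, hi, hi', hp⟩ := exists_factorization_fib r f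
    exact ⟨Z, i, p, fac, hi, hi'.1, hp⟩

lemma hasFactorizations_weq' : ModelCategory.HasFactorizations (fib R r) (weq' R r) where
  exists_trivialFibration f := exists_factorization_fib_inf_weq' r f
  exists_fibration f := exists_factorization_fib r f

/-- The extended spectral sequence with zero differentials and zero characteristic maps, which is
a given module in all bidegrees of each page. -/
noncomputable def const (V : ℕ → ModuleCat.{u} R) : ExtendedSpectralSequence R where
  page s := HomologicalComplex.zeroDifferential _ (fun _ => V s)
  char _ _ := 0

variable {R}

lemma isZero_const_page {V : ℕ → ModuleCat.{u} R} {s : ℕ} (hV : IsZero (V s)) :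
    IsZero ((const R V).page s) := by
  rw [IsZero.iff_id_eq_zero]
  ext1 pn
  exact hV.eq_of_src _ _

lemma isZero_const {V : ℕ → ModuleCat.{u} R} (hV : ∀ s, IsZero (V s)) : IsZero (const R V) where
  unique_to Y := ⟨
    { default :=
        { hom s := 0
          comm s pn := zero_comp.trans zero_comp.symm }
      uniq f := by
        ext1 s
        exact (isZero_const_page (hV s)).eq_of_src _ _ }⟩
  unique_from Y := ⟨
    { default :=
        { hom s := 0
          comm s pn := by
            rw [HomologicalComplex.homologyMap_zero, comp_zero]
            exact comp_zero.symm }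
      uniq f := by
        ext1 s
        exact (isZero_const_page (hV s)).eq_of_tgt _ _ }⟩

end ExtendedSpectralSequence

theorem propositionP (R : Type u) [CommRing R] (r : ℕ) :
    HasLimits (ExtendedSpectralSequence R) ∧ HasColimits (ExtendedSpectralSequence R) ∧
    ∃ M M' : ModelCategory (ExtendedSpectralSequence R),
      (M.Fib = ExtendedSpectralSequence.fib R r ∧ M.Weq = ExtendedSpectralSequence.weq R r) ∧
      (M'.Fib = ExtendedSpectralSequence.fib R r ∧ M'.Weq = ExtendedSpectralSequence.weq' R r) ∧
      ModelCategory.IsRightBousfieldLocalization M' M ∧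
      ModelCategory.IsQuillenAdjunction M M'
        (Adjunction.id (C := ExtendedSpectralSequence R)) ∧
      (Nontrivial R → ¬ ModelCategory.IsQuillenEquivalence M M'
        (Adjunction.id (C := ExtendedSpectralSequence R))) := by
  have h := ExtendedSpectralSequence.hasFactorizations_weq R r
  have h' := ExtendedSpectralSequence.hasFactorizations_weq' R r
  let M := ModelCategory.ofHasFactorizations h
  let M' := ModelCategory.ofHasFactorizations h'
  have hle : ExtendedSpectralSequence.weq' R r ≤ ExtendedSpectralSequence.weq R r :=
    fun _ _ _ hf => hf.1
  have hcof : M.Cof ≤ M'.Cof := MorphismProperty.antitone_llp (inf_le_inf le_rfl hle)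
  refine ⟨inferInstance, inferInstance, M, M', ⟨rfl, rfl⟩, ⟨rfl, rfl⟩, ⟨rfl, hle⟩,
    ⟨fun f hf => hcof _ hf, fun f hf hf' => ⟨hcof _ hf, h'.llp_le _ ?_⟩⟩, fun _ H => ?_⟩
  · exact h.llp_inf_eq.le _ ⟨hf, hf'⟩
  · let Z := ExtendedSpectralSequence.const R (fun _ => ModuleCat.of R PUnit.{u + 1})
    -- The map `0 ⟶ Y` is invisible on page `r` but not an isomorphism on page `r + 1`. Its source
    -- is initial, hence cofibrant, and its target is fibrant because `0` is also terminal and has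
    -- zero pages.
    let Y := ExtendedSpectralSequence.const R
      (fun s => if s ≤ r then ModuleCat.of R PUnit.{u + 1} else ModuleCat.of R R)
    have hV : IsZero (ModuleCat.of R PUnit.{u + 1}) := ModuleCat.isZero_of_subsingleton _
    have hZ : IsZero Z := ExtendedSpectralSequence.isZero_const (fun _ => hV)
    have hcofZ : @IsCofibrant _ _ M.categoryWithCofibrations _ Z := by
      let := M
      exact (isCofibrant_iff_of_isInitial (𝟙 Z) hZ.isInitial).2 inferInstance
    have hfibY : @IsFibrant _ _ M'.categoryWithFibrations _ Y := by
      refine (isFibrant_iff_of_isTerminal (hZ.from_ Y) hZ.isTerminal).2 ⟨?_⟩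
      intro s hs pn x
      exact ⟨0, Subsingleton.elim (α := PUnit) _ _⟩
    have key := H.weq_iff hcofZ hfibY (hZ.to_ Y)
    have hY (s) (hs : s ≤ r) : IsZero (Y.page s) :=
      ExtendedSpectralSequence.isZero_const_page (by rwa [if_pos hs])
    have h₁ : ExtendedSpectralSequence.weq R r (hZ.to_ Y) := by
      have : IsIso ((hZ.to_ Y).hom r) := isIso_of_source_target_iso_zero _
        (ExtendedSpectralSequence.isZero_const_page hV).isoZero (hY r le_rfl).isoZero
      exact inferInstanceAs (QuasiIso ((hZ.to_ Y).hom r))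
    have e : Adjunction.id.homEquiv Z Y (hZ.to_ Y) = hZ.to_ Y := hZ.eq_of_src _ _
    have h₂ : ExtendedSpectralSequence.weq' R r (hZ.to_ Y) := key.2 (e ▸ h₁)
    have := h₂.2 (r + 1) (Nat.lt_succ_self r)
    have hY' : IsZero (Y.page (r + 1)) := (ExtendedSpectralSequence.isZero_const_page hV).of_iso
      (asIso ((hZ.to_ Y).hom (r + 1))).symm
    have hR : IsZero (if r + 1 ≤ r then ModuleCat.of R PUnit.{u + 1} else ModuleCat.of R R) :=
      (HomologicalComplex.eval _ _ (0 : ℤ × ℤ)).map_isZero hY'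
    rw [if_neg (Nat.not_succ_le_self r)] at hR
    exact not_subsingleton R (ModuleCat.subsingleton_of_isZero hR)
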